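/- Let $l>-\frac12$, let $q:(0,\infty)\to\mathbb R$ be locally integrable with $xq(x)\in L^1(0,1)$, and let $\tau=-\frac{d^2}{dx^2}+\frac{l(l+1)}{x^2}+q(x)$ on $(0,\infty)$. For $z\in\mathbb C$ let $\phi(z,\cdot)$ and $\theta(z,\cdot)$ be solutions of $\tau u=zu$ (that is, $u$ is differentiable, $u'$ is locally absolutely continuous, and the equation holds almost everywhere) which, for each $x>0$, are entire functions of $z$, and which for $0<x\le 1$ have the form $$\phi(z,x)=x^{l+1}\widetilde\phi(z,x),\qquad \theta(z,x)=\frac{x^{-l}}{2l+1}\,\widetilde\theta(z,x),$$ with $\widetilde\phi,\widetilde\theta$ continuous on $\mathbb C\times[0,1]$ and $\widetilde\phi(z,0)=\widetilde\theta(z,0)=1$ for all $z$. Write $W_x(f,g)=f(x)g'(x)-f'(x)g(x)$, $\phi^{(i)}=\partial_z^i\phi$, $\theta^{(i)}=\partial_z^i\theta$, $n_l=\lfloor l+\frac12\rfloor$, and $C^\theta_{l,k}=\frac{1}{4^k(l-k+\frac12)_k}$ with $(x)_k=x(x+1)\cdots(x+k-1)$. Then $\phi^{(k)}(z,\cdot)$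 and $\theta^{(k)}(z,\cdot)$ are differentiable in $x$ on $(0,\infty)$ for all $k\in\mathbb N_0$ and $z\in\mathbb C$, and for all $z,\zeta\in\mathbb C$ and $i,j\in\mathbb N_0$: 1. $W_x(\theta(z),\phi(z))=1$ for all $x>0$. 2. $\lim_{x\to0}W_x(\theta(z),\phi(\zeta))=1$. 3. $\lim_{x\to0}W_x(\phi^{(i)}(z),\phi^{(j)}(\zeta))=0$. 4. $\lim_{x\to0}W_x(\theta^{(i)}(z),\phi^{(j)}(\zeta))=0$ if $i+j\ge1$. 5. $$\lim_{x\to0}W_x(\theta^{(i)}(z),\theta^{(j)}(\zeta))=\begin{cases}\infty,& i\ne j,\ i+j<n_l,\\ \infty,& i\neq j,\ i+j=n_l,\text{ and } \big(ij=0\text{ or }n_l\ne l+\frac12\big),\\ \dfrac{2(j-i)}{(2l+1)^2}\,C^\theta_{l,j}C^\theta_{l,i},& i+j=n_l,\ ij>0,\text{ and }\big(i=j\text{ or }n_l=l+\frac12\big),\end{cases}$$ where a limit $\infty$ means that the absolute value tends to $+\infty$. (For $i=j$ the third value is $0$.) 6. There is an entire function $F$ such that $$F^{(n_l+1)}(z)=\lim_{x\to0}x^{-(l+1)}\theta^{(n_l+1)}(z,x)\quad\text{for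 all }z\in\mathbb C,$$ and $F$ can be chosen real (that is, $F(\bar z)=\overline{F(z)}$) if $\theta$ is real (that is, $\theta(\bar z,x)=\overline{\theta(z,x)}$). For every such entire $F$, if $i+j\ge n_l+1$, then $$\lim_{x\to0}W_x(\theta^{(i)}(z),\theta^{(j)}(\zeta))=\begin{cases}-F^{(i)}(z),& j=0,\\ F^{(j)}(\zeta),& i=0,\\ 0,& ij\ne0.\end{cases}$$ -/

import Mathlib

open Filter Topology Set MeasureTheory

/-- `u` solves `τ u = z u` on `(0, ∞)`, where `τ = -d²/dx² + l (l + 1) / x² + q(x)`, in the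
Carathéodory sense: `u` is differentiable, `u'` is locally absolutely continuous, and the
differential equation holds almost everywhere. -/
def IsBesselSolution (l : ℝ) (q : ℝ → ℝ) (z : ℂ) (u : ℝ → ℂ) : Prop :=
  (∀ x : ℝ, 0 < x → DifferentiableAt ℝ u x) ∧
  (∀ a b : ℝ, 0 < a → a ≤ b → AbsolutelyContinuousOnInterval (deriv u) a b) ∧
  (∀ᵐ x ∂(volume.restrict (Ioi (0 : ℝ))),
    -deriv (deriv u) x + ((l * (l + 1) / x ^ 2 + q x : ℝ) : ℂ) * u x = z * u x)

/-- The Wronskian `W_x(f, g) = f(x) g'(x) - f'(x) g(x)`. -/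
noncomputable def wronskianAt (f g : ℝ → ℂ) (x : ℝ) : ℂ :=
  f x * deriv g x - deriv f x * g x

/-- The function `x ↦ ∂ᵏu/∂zᵏ (z, x)`, for `u` a function of `(z, x)`. -/
noncomputable def zDeriv (u : ℂ → ℝ → ℂ) (k : ℕ) (z : ℂ) : ℝ → ℂ :=
  fun x => iteratedDeriv k (fun w => u w x) z

/-- A family `u(z, ·)` of solutions of `τ u = z u`, entire with respect to `z`, of the form
`u(z, x) = c x ^ s ũ(z, x)` on `(0, 1]`, where `ũ` is continuous on `ℂ × [0, 1]` and
`ũ(z, 0) = 1` for all `z`. -/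
structure IsNormalizedEntireSolution (l : ℝ) (q : ℝ → ℝ) (c s : ℝ) (u : ℂ → ℝ → ℂ) : Prop where
  solves : ∀ z : ℂ, IsBesselSolution l q z (u z)
  entire : ∀ x : ℝ, 0 < x → Differentiable ℂ (fun z => u z x)
  normalized : ∃ v : ℂ → ℝ → ℂ,
    ContinuousOn (fun p : ℂ × ℝ => v p.1 p.2) (univ ×ˢ Icc (0 : ℝ) 1) ∧
    (∀ z : ℂ, v z 0 = 1) ∧
    ∀ z : ℂ, ∀ x ∈ Ioc (0 : ℝ) 1, u z x = ((c * x ^ s : ℝ) : ℂ) * v z x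

/-- The integer `n_l = ⌊l + 1/2⌋` (for `l > -1/2`). -/
noncomputable def nBessel (l : ℝ) : ℕ := ⌊l + 1 / 2⌋₊

/-- The coefficient `C^θ_{l,k} = 1 / (4 ^ k (l - k + 1/2)_k)`, with the Pochhammer symbol
`(x)_k = x (x + 1) ⋯ (x + k - 1)`. -/
noncomputable def cTheta (l : ℝ) (k : ℕ) : ℝ :=
  1 / (4 ^ k * (ascPochhammer ℝ k).eval (l - k + 1 / 2))

/-- The entire function `F` is a Frobenius part of `θ`:
`F^(n_l + 1)(z) = lim_{x → 0} x ^ (-(l + 1)) ∂_z^(n_l + 1) θ(z, x)` for all `z`. -/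
def IsFrobeniusPart (l : ℝ) (θ : ℂ → ℝ → ℂ) (F : ℂ → ℂ) : Prop :=
  Differentiable ℂ F ∧
  ∀ z : ℂ, Tendsto (fun x : ℝ => ((x ^ (-(l + 1)) : ℝ) : ℂ) * zDeriv θ (nBessel l + 1) z x)
    (𝓝[>] 0) (𝓝 (iteratedDeriv (nBessel l + 1) F z))

/-! Everything is read off from the leading powers of `x` at zero. The equation with `q = 0`, `z =
0` is solved by `x ^ s` and `x ^ (1 - s)` for `s = l + 1` or `s = -l`. In the Lagrange identity for
`x ^ (1 - s)` and a solution `u = c x ^ s v` the singular potential cancels and the integrable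
function `(x q - z x) c v` remains. Hence `x ^ (1 - s) u'` converges, and de l'Hospital forces the
limit `s c`.

Derivatives in `z` come from complex analysis. A locally bounded, pointwise convergent family of
entire functions converges together with all its derivatives, so limits at `x = 0`, and the
derivative in `x` itself, commute with `∂_z ^ k`. The limits for `φ` and `θ` are constant in `z`, so
`φ^(k) = o(x ^ (l + 1))` and `θ^(k) = o(x ^ (-l))` for `k ≥ 1`; with the constancy of `W(θ(z),
φ(z))` this gives items 1 to 4.

Items 5 and 6 need sharper information on `θ^(k)`, which variation of constants provides: `θ^(k) =
W(θ, θ^(k)) φ - W(φ, θ^(k)) θ`, where the derivative of `W(u(z), θ^(k)(z))` in `x` is `-k u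
θ^(k-1)`. Each step gains `x ^ 2`, so that `θ^(k) ~ C x ^ (2 k - l)` as long as `2 k < 2 l + 1`. At
`k = n_l + 1` the exponent of `φ` takes over: `W(θ, θ^(k))` has a limit `L(z)` and `θ^(k) = (L +
o(1)) x ^ (l + 1)`. The function `L` is entire, and `F` is an `(n_l + 1)`-fold primitive of it.

The Wronskians of item 5 then behave like `(j - i) x ^ (2 (i + j) - (2 l + 1))`. Two cases escape
this: if `n_l = l + 1/2` and `ij = 0` the divergence is logarithmic, and if `i = j` the leading
coefficient vanishes and the mean value theorem in `z` is used. The main lemmas are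
`EventuallyLocallyBounded.tendsto_iteratedDeriv`, `IsNormalizedEntireSolution.deriv_asymptotics`,
`IsBesselPair.powerBounded_step`, `IsBesselPair.tendsto_singular_zDeriv` and
`IsBesselPair.exists_tendsto_singular_zDeriv`. -/

/-! ### Locally bounded families of entire functions. -/

/-- A family of functions of `z` is eventually uniformly bounded on every disc. -/
def EventuallyLocallyBounded {ι : Type*} (𝓕 : Filter ι) (g : ι → ℂ → ℂ) : Prop :=
  ∀ R : ℝ, ∃ M : ℝ, ∀ᶠ a in 𝓕, ∀ z : ℂ, ‖z‖ ≤ R → ‖g a z‖ ≤ M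

theorem norm_iteratedDeriv_le_of_entire {g : ℂ → ℂ} (hg : Differentiable ℂ g) {R M : ℝ}
    (hM : ∀ z : ℂ, ‖z‖ ≤ R + 1 → ‖g z‖ ≤ M) (k : ℕ) {z : ℂ} (hz : ‖z‖ ≤ R) :
    ‖iteratedDeriv k g z‖ ≤ k.factorial * M := by
  have h := Complex.norm_iteratedDeriv_le_of_forall_mem_sphere_norm_le (c := z) (R := 1) (C := M)
    (f := g) k one_pos hg.diffContOnCl (fun w hw => hM w ?_)
  · simpa using h
  · have h1 : ‖w - z‖ = 1 := by simpa using hw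
    calc ‖w‖ = ‖(w - z) + z‖ := by ring_nf
      _ ≤ ‖w - z‖ + ‖z‖ := norm_add_le _ _
      _ ≤ R + 1 := by linarith

theorem Differentiable.iteratedDeriv_entire {g : ℂ → ℂ} (hg : Differentiable ℂ g) (k : ℕ) :
    Differentiable ℂ (iteratedDeriv k g) :=
  (hg.contDiff (n := ⊤)).differentiable_iteratedDeriv k (by exact_mod_cast WithTop.coe_lt_top _)

theorem EventuallyLocallyBounded.of_iteratedDeriv {ι : Type*} {𝓕 : Filter ι} {g : ι → ℂ → ℂ}
    (hg : ∀ᶠ a in 𝓕, Differentiable ℂ (g a)) (hb : EventuallyLocallyBounded 𝓕 g) (k : ℕ) :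
    EventuallyLocallyBounded 𝓕 (fun a => iteratedDeriv k (g a)) := by
  intro R
  obtain ⟨M, hM⟩ := hb (R + 1)
  refine ⟨k.factorial * M, ?_⟩
  filter_upwards [hg, hM] with a h1 h2 z hz
  exact norm_iteratedDeriv_le_of_entire h1 h2 k hz

/-- Cauchy's estimate bounds the first derivatives, so the family is equi-Lipschitz near each point
and so is its limit; pointwise convergence at the centre then controls a whole ball. -/
theorem EventuallyLocallyBounded.tendstoLocallyUniformlyOn {ι : Type*} {𝓕 : Filter ι} [𝓕.NeBot]
    {g : ι → ℂ → ℂ} {g₀ : ℂ → ℂ}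
    (hg : ∀ᶠ a in 𝓕, Differentiable ℂ (g a)) (hb : EventuallyLocallyBounded 𝓕 g)
    (hlim : ∀ z, Tendsto (fun a => g a z) 𝓕 (𝓝 (g₀ z))) :
    TendstoLocallyUniformlyOn g g₀ 𝓕 univ := by
  rw [Metric.tendstoLocallyUniformlyOn_iff]
  intro ε hε z₀ _
  obtain ⟨L, hL⟩ := (hb.of_iteratedDeriv hg 1) (‖z₀‖ + 1)
  have hlip : ∀ᶠ a in 𝓕, ∀ z ∈ Metric.closedBall z₀ 1, dist (g a z₀) (g a z) ≤ |L| * dist z₀ z := by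
    filter_upwards [hg, hL] with a h1 h2 z hz
    have := (convex_closedBall z₀ 1).norm_image_sub_le_of_norm_deriv_le (𝕜 := ℂ) (f := g a)
      (C := |L|) (x := z) (y := z₀) (fun x _ => h1 x) (fun x hx => ?_) hz (by simp)
    · simpa [dist_eq_norm] using this
    · have h3 := h2 x ?_
      · rw [iteratedDeriv_one] at h3
        exact h3.trans (le_abs_self L)
      · have : ‖x - z₀‖ ≤ 1 := by simpa [dist_eq_norm] using hx
        calc ‖x‖ = ‖z₀ + (x - z₀)‖ := by ring_nf
          _ ≤ ‖z₀‖ + ‖x - z₀‖ := norm_add_le _ _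
          _ ≤ ‖z₀‖ + 1 := by linarith
  have hlip₀ : ∀ z ∈ Metric.closedBall z₀ 1, dist (g₀ z₀) (g₀ z) ≤ |L| * dist z₀ z := by
    intro z hz
    refine le_of_tendsto ((hlim z₀).dist (hlim z)) ?_
    filter_upwards [hlip] with a ha using ha z hz
  set δ : ℝ := min 1 (ε / (3 * (|L| + 1))) with hδ
  have hδ0 : 0 < δ := by positivity
  refine ⟨Metric.ball z₀ δ, mem_nhdsWithin_of_mem_nhds (Metric.ball_mem_nhds _ hδ0), ?_⟩
  filter_upwards [hlip, (Metric.tendsto_nhds.1 (hlim z₀)) (ε / 3) (by positivity)] with a h1 h2 z hz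
  have hz1 : z ∈ Metric.closedBall z₀ 1 :=
    Metric.mem_closedBall.2 ((Metric.mem_ball.1 hz).le.trans (min_le_left _ _))
  have hd : |L| * dist z₀ z ≤ ε / 3 := by
    have h3 : dist z₀ z ≤ ε / (3 * (|L| + 1)) := by
      rw [dist_comm]
      exact (Metric.mem_ball.1 hz).le.trans (min_le_right _ _)
    calc |L| * dist z₀ z ≤ (|L| + 1) * (ε / (3 * (|L| + 1))) := by
          gcongr; linarith
      _ = ε / 3 := by field_simp
  have h4 := h1 z hz1
  have h5 := hlip₀ z hz1
  have t1 := dist_triangle (g₀ z) (g₀ z₀) (g a z)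
  have t2 := dist_triangle (g₀ z₀) (g a z₀) (g a z)
  rw [dist_comm (g₀ z) (g₀ z₀)] at t1
  rw [dist_comm (g₀ z₀) (g a z₀)] at t2
  linarith

theorem EventuallyLocallyBounded.differentiable_lim {ι : Type*} {𝓕 : Filter ι} [𝓕.NeBot]
    {g : ι → ℂ → ℂ} {g₀ : ℂ → ℂ} (hg : ∀ᶠ a in 𝓕, Differentiable ℂ (g a))
    (hb : EventuallyLocallyBounded 𝓕 g) (hlim : ∀ z, Tendsto (fun a => g a z) 𝓕 (𝓝 (g₀ z))) :
    Differentiable ℂ g₀ := by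
  rw [← differentiableOn_univ]
  exact (hb.tendstoLocallyUniformlyOn hg hlim).differentiableOn
    (hg.mono fun a h => h.differentiableOn) isOpen_univ

theorem EventuallyLocallyBounded.tendsto_iteratedDeriv {ι : Type*} {𝓕 : Filter ι} [𝓕.NeBot]
    {g : ι → ℂ → ℂ} {g₀ : ℂ → ℂ} (hg : ∀ᶠ a in 𝓕, Differentiable ℂ (g a))
    (hb : EventuallyLocallyBounded 𝓕 g) (hlim : ∀ z, Tendsto (fun a => g a z) 𝓕 (𝓝 (g₀ z)))
    (k : ℕ) (z : ℂ) :
    Tendsto (fun a => iteratedDeriv k (g a) z) 𝓕 (𝓝 (iteratedDeriv k g₀ z)) := by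
  induction k generalizing z with
  | zero => simpa using hlim z
  | succ k ih =>
    simp only [iteratedDeriv_succ]
    have h1 : ∀ᶠ a in 𝓕, Differentiable ℂ (iteratedDeriv k (g a)) :=
      hg.mono fun a h => h.iteratedDeriv_entire k
    exact (((hb.of_iteratedDeriv hg k).tendstoLocallyUniformlyOn h1 ih).deriv
      (h1.mono fun a h => h.differentiableOn) isOpen_univ).tendsto_at (mem_univ z)

/-- If `u(z, ·)` is differentiable near `x`, with derivative locally bounded in `z`, then the
`x`-derivative is entire in `z` and commutes with `∂_z^k`. -/
theorem hasDerivAt_iteratedDeriv {u u' : ℂ → ℝ → ℂ} {x : ℝ}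
    (hu : ∀ᶠ y in 𝓝 x, Differentiable ℂ (fun z => u z y))
    (hd : ∀ᶠ y in 𝓝 x, ∀ z, HasDerivAt (u z) (u' z y) y)
    (hb : EventuallyLocallyBounded (𝓝 x) (fun y z => u' z y)) :
    Differentiable ℂ (fun z => u' z x) ∧ ∀ (k : ℕ) (z : ℂ),
      HasDerivAt (fun y => iteratedDeriv k (fun w => u w y) z)
        (iteratedDeriv k (fun w => u' w x) z) x := by
  have hux : Differentiable ℂ (fun z => u z x) := hu.self_of_nhds
  -- The difference quotients in `x` form a family of entire functions of `z`, locally bounded by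
  -- the mean value inequality; `∂_z ^ k` therefore passes to their limit.
  set g : ℝ → ℂ → ℂ := fun y z => ((y - x : ℝ) : ℂ)⁻¹ * (u z y - u z x) with hg
  have hgd : ∀ᶠ y in 𝓝[≠] x, Differentiable ℂ (g y) := by
    filter_upwards [nhdsWithin_le_nhds hu] with y hy
    exact (hy.sub hux).const_mul _
  have hgb : EventuallyLocallyBounded (𝓝[≠] x) g := by
    intro R
    obtain ⟨M, hM⟩ := hb R
    obtain ⟨δ, hδ, hball⟩ := Metric.eventually_nhds_iff_ball.1 (hM.and hd)
    refine ⟨|M|, ?_⟩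
    filter_upwards [self_mem_nhdsWithin,
      mem_nhdsWithin_of_mem_nhds (Metric.ball_mem_nhds x hδ)] with y hyx hy z hz
    have h1 := (convex_ball x δ).norm_image_sub_le_of_norm_hasDerivWithin_le (f := u z) (f' := u' z)
      (C := |M|) (x := x) (y := y) (fun t ht => ((hball t ht).2 z).hasDerivWithinAt)
      (fun t ht => ((hball t ht).1 z hz).trans (le_abs_self M)) (Metric.mem_ball_self hδ) hy
    have h2 : (0 : ℝ) < ‖y - x‖ := norm_pos_iff.2 (sub_ne_zero.2 hyx)
    simp only [hg, norm_mul, norm_inv, Complex.norm_real]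
    rw [inv_mul_le_iff₀ h2]
    linarith
  have hgl : ∀ z, Tendsto (fun y => g y z) (𝓝[≠] x) (𝓝 (u' z x)) := by
    intro z
    have h1 := (hasDerivAt_iff_tendsto_slope.1 (hd.self_of_nhds z))
    refine h1.congr fun y => ?_
    simp [slope, hg]
  refine ⟨hgb.differentiable_lim hgd hgl, fun k z => ?_⟩
  rw [hasDerivAt_iff_tendsto_slope]
  refine (hgb.tendsto_iteratedDeriv hgd hgl k z).congr' ?_
  filter_upwards [nhdsWithin_le_nhds hu] with y hy
  have h1 : ContDiff ℂ k (fun z => u z y) := hy.contDiff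
  have h2 : ContDiff ℂ k (fun z => u z x) := hux.contDiff
  simp only [hg]
  rw [iteratedDeriv_const_mul_field, iteratedDeriv_fun_sub h1.contDiffAt h2.contDiffAt]
  simp [slope]

/-! ### Complex absolutely continuous functions and the Lagrange identity. -/

theorem AbsolutelyContinuousOnInterval.comp_re {f : ℝ → ℂ} {a b : ℝ}
    (hf : AbsolutelyContinuousOnInterval f a b) :
    AbsolutelyContinuousOnInterval (fun x => (f x).re) a b := by
  rw [absolutelyContinuousOnInterval_iff] at hf ⊢
  intro ε hε
  obtain ⟨δ, hδ, h⟩ := hf ε hε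
  refine ⟨δ, hδ, fun E h1 h2 => (Finset.sum_le_sum fun i _ => ?_).trans_lt (h E h1 h2)⟩
  rw [Real.dist_eq, Complex.dist_eq, ← Complex.sub_re]
  exact Complex.abs_re_le_norm _

theorem AbsolutelyContinuousOnInterval.comp_im {f : ℝ → ℂ} {a b : ℝ}
    (hf : AbsolutelyContinuousOnInterval f a b) :
    AbsolutelyContinuousOnInterval (fun x => (f x).im) a b := by
  rw [absolutelyContinuousOnInterval_iff] at hf ⊢
  intro ε hε
  obtain ⟨δ, hδ, h⟩ := hf ε hε
  refine ⟨δ, hδ, fun E h1 h2 => (Finset.sum_le_sum fun i _ => ?_).trans_lt (h E h1 h2)⟩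
  rw [Real.dist_eq, Complex.dist_eq, ← Complex.sub_im]
  exact Complex.abs_im_le_norm _

theorem AbsolutelyContinuousOnInterval.ae_hasDerivAt_complex {f : ℝ → ℂ} {a b : ℝ}
    (hf : AbsolutelyContinuousOnInterval f a b) :
    ∀ᵐ x : ℝ, x ∈ uIcc a b → HasDerivAt f
      (((deriv (fun x => (f x).re) x : ℝ) : ℂ) + ((deriv (fun x => (f x).im) x : ℝ) : ℂ) * Complex.I) x := by
  filter_upwards [hf.comp_re.ae_differentiableAt, hf.comp_im.ae_differentiableAt] with x h1 h2 hx
  have := (h1 hx).hasDerivAt.ofReal_comp.add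
    ((h2 hx).hasDerivAt.ofReal_comp.mul_const Complex.I)
  convert! this using 1
  ext y
  simp [Complex.re_add_im]

/-- The fundamental theorem of calculus for complex valued absolutely continuous functions. -/
theorem AbsolutelyContinuousOnInterval.integral_eq_sub_of_ae_hasDerivAt {f g : ℝ → ℂ} {a b : ℝ}
    (hf : AbsolutelyContinuousOnInterval f a b)
    (hg : ∀ᵐ x : ℝ, x ∈ uIcc a b → HasDerivAt f (g x) x) :
    IntervalIntegrable g volume a b ∧ ∫ x in a..b, g x = f b - f a := by
  have hae : ∀ᵐ x : ℝ, x ∈ uIoc a b →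
      (((deriv (fun x => (f x).re) x : ℝ) : ℂ) + ((deriv (fun x => (f x).im) x : ℝ) : ℂ) * Complex.I) = g x := by
    filter_upwards [hf.ae_hasDerivAt_complex, hg] with x h1 h2 hx
    exact (h1 (uIoc_subset_uIcc hx)).unique (h2 (uIoc_subset_uIcc hx))
  have i1 : IntervalIntegrable (fun x => ((deriv (fun x => (f x).re) x : ℝ) : ℂ)) volume a b :=
    ⟨hf.comp_re.intervalIntegrable_deriv.1.ofReal, hf.comp_re.intervalIntegrable_deriv.2.ofReal⟩
  have i2 : IntervalIntegrable (fun x => ((deriv (fun x => (f x).im) x : ℝ) : ℂ) * Complex.I)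
      volume a b :=
    IntervalIntegrable.mul_const ⟨hf.comp_im.intervalIntegrable_deriv.1.ofReal,
      hf.comp_im.intervalIntegrable_deriv.2.ofReal⟩ _
  refine ⟨(i1.add i2).congr_ae ((ae_restrict_iff' measurableSet_uIoc).2 hae), ?_⟩
  rw [← intervalIntegral.integral_congr_ae hae, intervalIntegral.integral_add i1 i2,
    intervalIntegral.integral_mul_const, intervalIntegral.integral_ofReal,
    intervalIntegral.integral_ofReal, hf.comp_re.integral_deriv_eq_sub,
    hf.comp_im.integral_deriv_eq_sub]
  apply Complex.ext <;> simp

theorem AbsolutelyContinuousOnInterval.ae_hasDerivAt_deriv {f : ℝ → ℂ} {a b : ℝ}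
    (hf : AbsolutelyContinuousOnInterval f a b) :
    ∀ᵐ x : ℝ, x ∈ uIcc a b → HasDerivAt f (deriv f x) x := by
  filter_upwards [hf.ae_hasDerivAt_complex] with x h hx
  exact (h hx).differentiableAt.hasDerivAt

theorem absolutelyContinuousOnInterval_of_deriv {f : ℝ → ℂ} {a b : ℝ}
    (hf : ∀ x ∈ uIcc a b, DifferentiableAt ℝ f x)
    (hf' : AbsolutelyContinuousOnInterval (deriv f) a b) :
    AbsolutelyContinuousOnInterval f a b := by
  obtain ⟨C, hC⟩ := hf'.exists_bound
  refine LipschitzOnWith.absolutelyContinuousOnInterval (K := C.toNNReal) ?_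
  refine Convex.lipschitzOnWith_of_nnnorm_deriv_le hf (fun x hx => ?_) (convex_uIcc a b)
  have h1 := hC x hx
  rw [← NNReal.coe_le_coe, coe_nnnorm]
  exact h1.trans (Real.le_coe_toNNReal C)

/-- The Lagrange identity in integrated form. -/
theorem wronskianAt_sub {f g : ℝ → ℂ} {a b : ℝ}
    (hf : ∀ x ∈ uIcc a b, DifferentiableAt ℝ f x)
    (hf' : AbsolutelyContinuousOnInterval (deriv f) a b)
    (hg : ∀ x ∈ uIcc a b, DifferentiableAt ℝ g x)
    (hg' : AbsolutelyContinuousOnInterval (deriv g) a b) :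
    IntervalIntegrable (fun x => f x * deriv (deriv g) x - deriv (deriv f) x * g x) volume a b ∧
    ∫ x in a..b, (f x * deriv (deriv g) x - deriv (deriv f) x * g x)
      = wronskianAt f g b - wronskianAt f g a := by
  have hfa := absolutelyContinuousOnInterval_of_deriv hf hf'
  have hga := absolutelyContinuousOnInterval_of_deriv hg hg'
  have hW : AbsolutelyContinuousOnInterval (wronskianAt f g) a b := (hfa.smul hg').sub (hf'.smul hga)
  refine hW.integral_eq_sub_of_ae_hasDerivAt ?_
  filter_upwards [hf'.ae_hasDerivAt_deriv, hg'.ae_hasDerivAt_deriv] with x h1 h2 hx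
  have h3 := ((hf x hx).hasDerivAt.mul (h2 hx)).sub ((h1 hx).mul (hg x hx).hasDerivAt)
  have h4 : wronskianAt f g = f * deriv g - deriv f * g := rfl
  rw [h4]
  convert! h3 using 1
  ring

/-! ### Bounds for solutions, locally uniform in the spectral parameter. -/

/-- On an interval on which `1 + |Q|` has small integral, a solution of `u'' = Q u` is controlled
by its initial data. -/
theorem norm_solution_le_of_integral_le {u : ℝ → ℂ} {Q : ℝ → ℂ} {K : ℝ → ℝ} {a b : ℝ} (hab : a ≤ b)
    (hu : ∀ x ∈ Icc a b, DifferentiableAt ℝ u x)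
    (hu' : AbsolutelyContinuousOnInterval (deriv u) a b)
    (hQ : ∀ᵐ x : ℝ, x ∈ Icc a b → deriv (deriv u) x = Q x * u x)
    (hQK : ∀ x ∈ Icc a b, 1 + ‖Q x‖ ≤ K x)
    (hK : IntervalIntegrable K volume a b) (hKi : ∫ x in a..b, K x ≤ 1 / 2)
    {s x : ℝ} (hs : s ∈ Icc a b) (hx : x ∈ Icc a b) :
    ‖u x‖ + ‖deriv u x‖ ≤ 2 * (‖u s‖ + ‖deriv u s‖) := by
  rw [← uIcc_of_le hab] at hu
  have hua := absolutelyContinuousOnInterval_of_deriv hu hu'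
  have hNc : ContinuousOn (fun x => ‖u x‖ + ‖deriv u x‖) (Icc a b) := by
    rw [← uIcc_of_le hab]
    exact hua.continuousOn.norm.add hu'.continuousOn.norm
  obtain ⟨m, hm, hmax⟩ := isCompact_Icc.exists_isMaxOn ⟨s, hs⟩ hNc
  set N : ℝ := ‖u m‖ + ‖deriv u m‖ with hN
  have hK0 : ∀ x ∈ Icc a b, 0 ≤ K x := fun x hx => by
    have := hQK x hx
    have := norm_nonneg (Q x)
    linarith
  have hsub : uIcc s m ⊆ uIcc a b := by
    rw [uIcc_of_le hab]; exact uIcc_subset_Icc hs hm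
  have hua' := hua.mono hsub
  have hu'' := hu'.mono hsub
  have e1 := (hua'.integral_eq_sub_of_ae_hasDerivAt hua'.ae_hasDerivAt_deriv)
  have e2 := (hu''.integral_eq_sub_of_ae_hasDerivAt hu''.ae_hasDerivAt_deriv)
  -- Integrating `u'` and `u''` from `s` to the maximum point `m` bounds the maximum `N` by the
  -- initial data plus `N / 2`, which is then absorbed.
  have key : ‖u m‖ + ‖deriv u m‖ ≤ ‖u s‖ + ‖deriv u s‖ + N * (1 / 2) := by
    have b1 : ‖u m - u s‖ ≤ ∫ x in uIoc s m, ‖deriv u x‖ := by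
      rw [← e1.2]; exact intervalIntegral.norm_integral_le_integral_norm_uIoc
    have b2 : ‖deriv u m - deriv u s‖ ≤ ∫ x in uIoc s m, ‖deriv (deriv u) x‖ := by
      rw [← e2.2]; exact intervalIntegral.norm_integral_le_integral_norm_uIoc
    have hsub2 : uIoc s m ⊆ Ioc a b := by
      rw [uIoc]; exact Ioc_subset_Ioc (le_min hs.1 hm.1) (max_le hs.2 hm.2)
    have i3 : IntegrableOn (fun x => N * K x) (Ioc a b) :=
      ((intervalIntegrable_iff_integrableOn_Ioc_of_le hab).1 hK).const_mul _
    have i1 : IntegrableOn (fun x => ‖deriv u x‖) (uIoc s m) :=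
      (intervalIntegrable_iff.1 e1.1).norm
    have i2 : IntegrableOn (fun x => ‖deriv (deriv u) x‖) (uIoc s m) :=
      (intervalIntegrable_iff.1 e2.1).norm
    have b3 : (∫ x in uIoc s m, ‖deriv u x‖) + (∫ x in uIoc s m, ‖deriv (deriv u) x‖)
        ≤ ∫ x in uIoc s m, N * K x := by
      rw [← integral_add i1 i2]
      refine setIntegral_mono_on_ae (i1.add i2) (i3.mono_set hsub2) measurableSet_uIoc ?_
      filter_upwards [hQ] with t ht hts
      have ht1 : t ∈ Icc a b := Ioc_subset_Icc_self (hsub2 hts)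
      have ht2 : ‖u t‖ + ‖deriv u t‖ ≤ N := hmax ht1
      rw [ht ht1, norm_mul]
      have ht3 := hQK t ht1
      have ht4 := norm_nonneg (Q t)
      have ht5 := norm_nonneg (u t)
      have ht6 := norm_nonneg (deriv u t)
      calc ‖deriv u t‖ + ‖Q t‖ * ‖u t‖ ≤ N + ‖Q t‖ * N := by
            gcongr <;> linarith
        _ = N * (1 + ‖Q t‖) := by ring
        _ ≤ N * K t := by
            apply mul_le_mul_of_nonneg_left ht3; linarith
    have b4 : ∫ x in uIoc s m, N * K x ≤ ∫ x in Ioc a b, N * K x := by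
      refine setIntegral_mono_set i3 ?_ hsub2.eventuallyLE
      refine (ae_restrict_iff' measurableSet_Ioc).2 (ae_of_all _ fun x hx => ?_)
      have := hK0 x (Ioc_subset_Icc_self hx)
      positivity
    have b5 : ∫ x in Ioc a b, N * K x ≤ N * (1 / 2) := by
      rw [integral_const_mul, ← intervalIntegral.integral_of_le hab]
      gcongr
    have n1 := norm_sub_norm_le (u m) (u s)
    have n2 := norm_sub_norm_le (deriv u m) (deriv u s)
    linarith
  have h1 : ‖u x‖ + ‖deriv u x‖ ≤ N := hmax hx
  linarith

/-- The coefficient `l (l + 1) / x ^ 2 + q x` of the equation. -/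
noncomputable def besselPotential (l : ℝ) (q : ℝ → ℝ) (x : ℝ) : ℝ := l * (l + 1) / x ^ 2 + q x

theorem locallyIntegrableOn_besselPotential (l : ℝ) {q : ℝ → ℝ}
    (hq : LocallyIntegrableOn q (Ioi 0)) :
    LocallyIntegrableOn (besselPotential l q) (Ioi 0) := by
  refine LocallyIntegrableOn.add ?_ hq
  refine ContinuousOn.locallyIntegrableOn ?_ measurableSet_Ioi
  exact continuousOn_const.div (by fun_prop) fun x hx => pow_ne_zero _ (ne_of_gt hx)

theorem IsBesselSolution.ae_deriv_deriv {l : ℝ} {q : ℝ → ℝ} {z : ℂ} {u : ℝ → ℂ}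
    (h : IsBesselSolution l q z u) :
    ∀ᵐ x : ℝ, 0 < x → deriv (deriv u) x = ((besselPotential l q x : ℂ) - z) * u x := by
  have := (ae_restrict_iff' measurableSet_Ioi).1 h.2.2
  filter_upwards [this] with x hx h0
  have h1 := hx h0
  rw [besselPotential]
  linear_combination -h1

/-- The majorant `K` depends on `R` but not on `z`, so one `δ` serves the whole disc. -/
theorem eventually_solution_bound {l : ℝ} {q : ℝ → ℝ} (hq : LocallyIntegrableOn q (Ioi 0))
    {u : ℂ → ℝ → ℂ} (hu : ∀ z, IsBesselSolution l q z (u z)) (R : ℝ) {y : ℝ} (hy : 0 < y) :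
    ∃ δ > 0, ∀ s ∈ Icc (y - δ) (y + δ), ∀ x ∈ Icc (y - δ) (y + δ), ∀ z : ℂ, ‖z‖ ≤ R →
      ‖u z x‖ + ‖deriv (u z) x‖ ≤ 2 * (‖u z s‖ + ‖deriv (u z) s‖) := by
  set K : ℝ → ℝ := fun x => (1 + R) + |besselPotential l q x| with hK
  have hKloc : LocallyIntegrableOn K (Ioi 0) :=
    (locallyIntegrableOn_const _).add (locallyIntegrableOn_besselPotential l hq).norm
  have hKi : ∀ a b : ℝ, 0 < a → a ≤ b → IntervalIntegrable K volume a b := by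
    intro a b ha hab
    rw [intervalIntegrable_iff_integrableOn_Icc_of_le hab]
    exact hKloc.integrableOn_compact_subset (fun x hx => lt_of_lt_of_le ha hx.1) isCompact_Icc
  have h2 : y / 2 ≤ 2 * y := by linarith
  have hc : ContinuousOn (fun x => ∫ t in (y / 2)..x, K t) (uIcc (y / 2) (2 * y)) := by
    apply intervalIntegral.continuousOn_primitive_interval
    rw [uIcc_of_le h2, ← intervalIntegrable_iff_integrableOn_Icc_of_le h2]
    exact hKi _ _ (by linarith) h2
  rw [uIcc_of_le h2] at hc
  have hcy : ContinuousAt (fun x => ∫ t in (y / 2)..x, K t) y :=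
    hc.continuousAt (Icc_mem_nhds (by linarith) (by linarith))
  -- An error `1 / 4` at each endpoint keeps the integral of `K` over `[y - δ, y + δ]` below `1 /
  -- 2`.
  obtain ⟨ε, hε, hεc⟩ := Metric.continuousAt_iff.1 hcy (1 / 4) (by norm_num)
  set δ := min (ε / 2) (y / 4) with hδ
  have hδ0 : 0 < δ := by positivity
  have hδ1 : δ ≤ ε / 2 := min_le_left _ _
  have hδ2 : δ ≤ y / 4 := min_le_right _ _
  refine ⟨δ, hδ0, fun s hs x hx z hz => ?_⟩
  have c1 := hεc (x := y - δ) (by rw [Real.dist_eq, abs_lt]; constructor <;> linarith)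
  have c2 := hεc (x := y + δ) (by rw [Real.dist_eq, abs_lt]; constructor <;> linarith)
  rw [Real.dist_eq, abs_lt] at c1 c2
  have hsplit := intervalIntegral.integral_interval_sub_left
    (hKi (y / 2) (y + δ) (by linarith) (by linarith))
    (hKi (y / 2) (y - δ) (by linarith) (by linarith))
  refine norm_solution_le_of_integral_le (u := u z) (Q := fun x => (besselPotential l q x : ℂ) - z)
    (K := K) (a := y - δ) (b := y + δ) (by linarith)
    (fun x hx => (hu z).1 x (by linarith [hx.1])) ((hu z).2.1 _ _ (by linarith) (by linarith))
    ?_ ?_ (hKi _ _ (by linarith) (by linarith)) (by linarith) hs hx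
  · filter_upwards [(hu z).ae_deriv_deriv] with t ht hts
    exact ht (by linarith [hts.1])
  · intro t _
    have := norm_sub_le (besselPotential l q t : ℂ) z
    rw [Complex.norm_real, Real.norm_eq_abs] at this
    simp only [hK]
    linarith

/-- A family of solutions whose initial data at one point are bounded locally in `z` is locally
bounded in `(z, x)`, together with its `x`-derivative. -/
theorem eventuallyLocallyBounded_solution {l : ℝ} {q : ℝ → ℝ} (hq : LocallyIntegrableOn q (Ioi 0))
    {u : ℂ → ℝ → ℂ} (hu : ∀ z, IsBesselSolution l q z (u z)) {x₀ : ℝ} (hx₀ : 0 < x₀)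
    (hb : ∀ R : ℝ, ∃ M : ℝ, ∀ z : ℂ, ‖z‖ ≤ R → ‖u z x₀‖ + ‖deriv (u z) x₀‖ ≤ M)
    {x : ℝ} (hx : 0 < x) :
    EventuallyLocallyBounded (𝓝 x) (fun y z => u z y) ∧
    EventuallyLocallyBounded (𝓝 x) (fun y z => deriv (u z) y) := by
  suffices H : ∀ R : ℝ, ∃ M : ℝ, ∀ᶠ y in 𝓝 x, ∀ z : ℂ, ‖z‖ ≤ R →
      ‖u z y‖ + ‖deriv (u z) y‖ ≤ M by
    constructor <;> intro R <;> obtain ⟨M, hM⟩ := H R <;> refine ⟨M, ?_⟩ <;>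
      filter_upwards [hM] with y hy z hz <;> have h1 := hy z hz
    · linarith [norm_nonneg (deriv (u z) y)]
    · linarith [norm_nonneg (u z y)]
  intro R
  -- Boundedness of the data at `s` and at `t` are equivalent for nearby points; the equivalence
  -- spreads over the connected set `(0, ∞)`.
  let P : ℝ → ℝ → Prop := fun s t =>
    (∃ M : ℝ, ∀ z : ℂ, ‖z‖ ≤ R → ‖u z s‖ + ‖deriv (u z) s‖ ≤ M) ↔
    (∃ M : ℝ, ∀ z : ℂ, ‖z‖ ≤ R → ‖u z t‖ + ‖deriv (u z) t‖ ≤ M)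
  have hP : P x₀ x := by
    refine (isPreconnected_Ioi (a := (0 : ℝ))).induction₂ P (fun y hy => ?_)
      (fun _ _ _ _ _ _ h1 h2 => h1.trans h2) (fun _ _ _ _ h => h.symm) hx₀ hx
    obtain ⟨δ, hδ, h⟩ := eventually_solution_bound hq hu R hy
    have hym : y ∈ Icc (y - δ) (y + δ) := ⟨by linarith, by linarith⟩
    filter_upwards [mem_nhdsWithin_of_mem_nhds
      (Icc_mem_nhds (show y - δ < y by linarith) (show y < y + δ by linarith))] with t ht
    constructor
    · rintro ⟨M, hM⟩
      exact ⟨2 * M, fun z hz => (h y hym t ht z hz).trans (by linarith [hM z hz])⟩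
    · rintro ⟨M, hM⟩
      exact ⟨2 * M, fun z hz => (h t ht y hym z hz).trans (by linarith [hM z hz])⟩
  obtain ⟨M, hM⟩ := hP.1 (hb R)
  obtain ⟨δ, hδ, h⟩ := eventually_solution_bound hq hu R hx
  refine ⟨2 * M, ?_⟩
  filter_upwards [Icc_mem_nhds (show x - δ < x by linarith) (show x < x + δ by linarith)]
    with t ht z hz
  exact (h x ⟨by linarith, by linarith⟩ t ht z hz).trans (by linarith [hM z hz])

/-- The Wronskian of two solutions of the equation with spectral parameters `z`, `ζ`. -/
theorem IsBesselSolution.hasDerivAt_wronskianAt {l : ℝ} {q : ℝ → ℝ} {z ζ : ℂ} {u w : ℝ → ℂ}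
    (hu : IsBesselSolution l q z u) (hw : IsBesselSolution l q ζ w) {x : ℝ} (hx : 0 < x) :
    HasDerivAt (wronskianAt u w) ((z - ζ) * (u x * w x)) x := by
  have hcu : ContinuousOn (fun x => (z - ζ) * (u x * w x)) (Ioi 0) :=
    fun t ht => (continuousAt_const.mul ((hu.1 t ht).continuousAt.mul
      (hw.1 t ht).continuousAt)).continuousWithinAt
  -- The second derivatives exist only almost everywhere, but the integrand they produce is
  -- continuous, so its primitive is differentiable at every point.
  have hint : ∀ y : ℝ, 0 < y →
      ∫ t in x..y, (z - ζ) * (u t * w t) = wronskianAt u w y - wronskianAt u w x := by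
    intro y hy
    have hpos : ∀ t ∈ uIcc x y, 0 < t := fun t ht => lt_of_lt_of_le (lt_min hx hy) ht.1
    have hac : ∀ v : ℝ → ℂ, ∀ c : ℂ, IsBesselSolution l q c v →
        AbsolutelyContinuousOnInterval (deriv v) x y := by
      intro v c hv
      rcases le_total x y with h | h
      · exact hv.2.1 _ _ hx h
      · exact (hv.2.1 _ _ hy h).symm
    rw [← (wronskianAt_sub (fun t ht => hu.1 t (hpos t ht)) (hac u z hu)
      (fun t ht => hw.1 t (hpos t ht)) (hac w ζ hw)).2]
    apply intervalIntegral.integral_congr_ae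
    filter_upwards [hu.ae_deriv_deriv, hw.ae_deriv_deriv] with t h1 h2 ht
    have h0 := hpos t (uIoc_subset_uIcc ht)
    rw [h1 h0, h2 h0]
    ring
  have hd := intervalIntegral.integral_hasDerivAt_right (f := fun t => (z - ζ) * (u t * w t))
    (a := x) (b := x) IntervalIntegrable.refl
    (hcu.stronglyMeasurableAtFilter isOpen_Ioi x hx) (hcu.continuousAt (Ioi_mem_nhds hx))
  have := hd.add_const (wronskianAt u w x)
  refine this.congr_of_eventuallyEq ?_
  filter_upwards [Ioi_mem_nhds hx] with y hy
  rw [hint y hy]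
  ring

/-! ### Integration of power asymptotics at zero. -/

theorem norm_sub_le_of_norm_deriv_le_deriv {H H' : ℝ → ℂ} {B B' : ℝ → ℝ} {x y : ℝ} (hyx : y ≤ x)
    (hH : ∀ t ∈ Icc y x, HasDerivAt H (H' t) t) (hB : ∀ t ∈ Icc y x, HasDerivAt B (B' t) t)
    (hb : ∀ t ∈ Icc y x, ‖H' t‖ ≤ B' t) : ‖H x - H y‖ ≤ B x - B y := by
  have h := image_norm_le_of_norm_deriv_right_le_deriv_boundary' (f := fun t => H t - H y)
    (f' := H') (a := y) (b := x) (B := fun t => B t - B y) (B' := B')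
    (fun t ht => ((hH t ht).continuousAt.sub continuousAt_const).continuousWithinAt)
    (fun t ht => ((hH t (Ico_subset_Icc_self ht)).sub_const _).hasDerivWithinAt) (by simp)
    (fun t ht => ((hB t ht).continuousAt.sub continuousAt_const).continuousWithinAt)
    (fun t ht => ((hB t (Ico_subset_Icc_self ht)).sub_const _).hasDerivWithinAt)
    (fun t ht => hb t (Ico_subset_Icc_self ht))
  exact h (right_mem_Icc.2 hyx)

theorem norm_sub_le_of_norm_deriv_le_rpow {H H' : ℝ → ℂ} {s M x y : ℝ} (hs : s ≠ 0) (hy : 0 < y)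
    (hyx : y ≤ x) (hH : ∀ t ∈ Icc y x, HasDerivAt H (H' t) t)
    (hb : ∀ t ∈ Icc y x, ‖H' t‖ ≤ M * t ^ (s - 1)) :
    ‖H x - H y‖ ≤ M / s * (x ^ s - y ^ s) := by
  have := norm_sub_le_of_norm_deriv_le_deriv (B := fun t => M / s * t ^ s)
    (B' := fun t => M * t ^ (s - 1)) hyx hH (fun t ht => ?_) hb
  · linarith
  · have := (Real.hasDerivAt_rpow_const (x := t) (p := s)
      (Or.inl (lt_of_lt_of_le hy ht.1).ne')).const_mul (M / s)
    convert! this using 1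
    field_simp

theorem tendsto_rpow_zero {s : ℝ} (hs : 0 < s) : Tendsto (fun x : ℝ => x ^ s) (𝓝[>] 0) (𝓝 0) := by
  have := (Real.continuousAt_rpow_const 0 s (Or.inr hs.le)).tendsto
  rw [Real.zero_rpow hs.ne'] at this
  exact this.mono_left nhdsWithin_le_nhds

theorem tendsto_ofReal_rpow_zero {s : ℝ} (hs : 0 < s) :
    Tendsto (fun x : ℝ => ((x ^ s : ℝ) : ℂ)) (𝓝[>] 0) (𝓝 0) := by
  have := (Complex.continuous_ofReal.tendsto 0).comp (tendsto_rpow_zero hs)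
  rwa [Complex.ofReal_zero] at this

theorem tendsto_rpow_atTop_of_neg {s : ℝ} (hs : s < 0) :
    Tendsto (fun x : ℝ => x ^ s) (𝓝[>] 0) atTop := by
  have h := ((tendsto_rpow_zero (neg_pos.2 hs)).mono_right le_rfl)
  have h1 : Tendsto (fun x : ℝ => x ^ (-s)) (𝓝[>] 0) (𝓝[>] 0) := by
    refine tendsto_nhdsWithin_iff.2 ⟨h, ?_⟩
    filter_upwards [self_mem_nhdsWithin] with x hx using Real.rpow_pos_of_pos hx _
  refine (tendsto_inv_nhdsGT_zero.comp h1).congr' ?_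
  filter_upwards [self_mem_nhdsWithin] with x hx
  simp [Real.rpow_neg (le_of_lt hx)]

/-- From `|H'| ≤ ε x ^ (s - 1)` near zero for every `ε`, deduce `H = o(x ^ s)`. -/
theorem tendsto_rpow_mul_of_deriv_littleO {H H' : ℝ → ℂ} {s : ℝ} (hs : s ≠ 0)
    (hH : ∀ x : ℝ, 0 < x → HasDerivAt H (H' x) x)
    (hH' : Tendsto (fun x : ℝ => ((x ^ (1 - s) : ℝ) : ℂ) * H' x) (𝓝[>] 0) (𝓝 0))
    (h0 : 0 < s → Tendsto H (𝓝[>] 0) (𝓝 0)) :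
    Tendsto (fun x : ℝ => ((x ^ (-s) : ℝ) : ℂ) * H x) (𝓝[>] 0) (𝓝 0) := by
  rw [Metric.tendsto_nhds]
  intro ε hε
  -- Integration divides by `|s|`, leaving `ε / 3`; the remaining room absorbs the boundary term
  -- when `s < 0`.
  set η : ℝ := ε * |s| / 3 with hη
  have hη0 : 0 < η := by positivity
  have h1 := (Metric.tendsto_nhds.1 hH') η hη0
  obtain ⟨δ, hδ, hδb⟩ := (nhdsGT_basis (0 : ℝ)).eventually_iff.1 h1
  have hb : ∀ t ∈ Ioo 0 δ, ‖H' t‖ ≤ η * t ^ (s - 1) := by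
    intro t ht
    have h2 := (hδb ht).le
    rw [dist_zero_right, norm_mul, Complex.norm_real, Real.norm_of_nonneg (by positivity [ht.1]),
      Real.rpow_sub ht.1, Real.rpow_one, ] at h2
    rw [Real.rpow_sub ht.1, Real.rpow_one]
    have h3 := Real.rpow_pos_of_pos ht.1 s
    have := ht.1
    rw [div_mul_eq_mul_div, div_le_iff₀ h3] at h2
    rw [mul_div_assoc', le_div_iff₀ this]
    linarith
  have hsub : ∀ y x : ℝ, 0 < y → y ≤ x → x < δ → ‖H x - H y‖ ≤ η / s * (x ^ s - y ^ s) :=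
    fun y x hy hyx hx => norm_sub_le_of_norm_deriv_le_rpow hs hy hyx
      (fun t ht => hH t (lt_of_lt_of_le hy ht.1))
      (fun t ht => hb t ⟨lt_of_lt_of_le hy ht.1, lt_of_le_of_lt ht.2 hx⟩)
  have key : ∀ᶠ x in 𝓝[>] (0 : ℝ), ‖H x‖ ≤ 2 * ε / 3 * x ^ s := by
    -- For `s < 0` one integrates from the fixed point `δ / 2`, whose contribution is dominated by
    -- `x ^ s → ∞`; for `s > 0` one integrates from zero, where `H` vanishes.
    rcases lt_or_gt_of_ne hs with hneg | hpos
    · have h4 := (tendsto_rpow_atTop_of_neg hneg).eventually_ge_atTop (‖H (δ / 2)‖ / (ε / 3))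
      filter_upwards [h4, Ioo_mem_nhdsGT (show (0 : ℝ) < δ / 2 by positivity)] with x h4 hx
      have h5 := hsub x (δ / 2) hx.1 hx.2.le (by linarith)
      have h6 : η / s = - (ε / 3) := by
        rw [hη, abs_of_neg hneg]; field_simp
      rw [h6] at h5
      have h7 : 0 < (δ / 2) ^ s := by positivity
      rw [div_le_iff₀ (by positivity)] at h4
      have h8 := norm_sub_norm_le (H x) (H (δ / 2))
      rw [norm_sub_rev] at h8
      nlinarith
    · filter_upwards [Ioo_mem_nhdsGT hδ] with x hx
      have h5 : ‖H x - 0‖ ≤ η / s * (x ^ s - 0) := by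
        refine le_of_tendsto_of_tendsto (tendsto_const_nhds.sub (h0 hpos)).norm
          ((tendsto_const_nhds.sub (tendsto_rpow_zero hpos)).const_mul (η / s)) ?_
        filter_upwards [Ioo_mem_nhdsGT hx.1] with y hy
        exact hsub y x hy.1 hy.2.le hx.2
      have h6 : η / s = ε / 3 := by
        rw [hη, abs_of_pos hpos]; field_simp
      rw [h6] at h5
      have := Real.rpow_pos_of_pos hx.1 s
      simp only [sub_zero] at h5
      nlinarith
  filter_upwards [key, self_mem_nhdsWithin] with x hx hx0
  have hx0 : 0 < x := hx0
  rw [dist_zero_right, norm_mul, Complex.norm_real, Real.norm_of_nonneg (by positivity),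
    Real.rpow_neg hx0.le]
  have := Real.rpow_pos_of_pos hx0 s
  rw [inv_mul_lt_iff₀ this]
  nlinarith

/-- A de l'Hospital rule for powers. -/
theorem tendsto_rpow_mul_of_deriv {G G' : ℝ → ℂ} {s : ℝ} {c : ℂ} (hs : s ≠ 0)
    (hG : ∀ x : ℝ, 0 < x → HasDerivAt G (G' x) x)
    (hG' : Tendsto (fun x : ℝ => ((x ^ (1 - s) : ℝ) : ℂ) * G' x) (𝓝[>] 0) (𝓝 c))
    (h0 : 0 < s → Tendsto G (𝓝[>] 0) (𝓝 0)) :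
    Tendsto (fun x : ℝ => ((x ^ (-s) : ℝ) : ℂ) * G x) (𝓝[>] 0) (𝓝 (c / s)) := by
  have hs' : (s : ℂ) ≠ 0 := by exact_mod_cast hs
  -- Subtracting `(c / s) x ^ s`, a primitive of the leading term, leaves the case of limit zero.
  have h := tendsto_rpow_mul_of_deriv_littleO (H := fun x => G x - c / s * ((x ^ s : ℝ) : ℂ))
    (H' := fun x => G' x - c / s * ((s * x ^ (s - 1) : ℝ) : ℂ)) hs (fun x hx => ?_) ?_ ?_
  · have h2 := h.add_const (c / s)
    rw [zero_add] at h2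
    refine h2.congr' ?_
    filter_upwards [self_mem_nhdsWithin] with x hx
    have hx : 0 < x := hx
    have : ((x ^ (-s) : ℝ) : ℂ) * ((x ^ s : ℝ) : ℂ) = 1 := by
      rw [← Complex.ofReal_mul, ← Real.rpow_add hx]; simp
    linear_combination (-(c / s)) * this
  · exact (hG x hx).sub
      ((Real.hasDerivAt_rpow_const (Or.inl hx.ne')).ofReal_comp.const_mul (c / s))
  · have h2 := hG'.sub_const c
    rw [sub_self] at h2
    refine h2.congr' ?_
    filter_upwards [self_mem_nhdsWithin] with x hx
    have hx : 0 < x := hx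
    have : ((x ^ (1 - s) : ℝ) : ℂ) * ((x ^ (s - 1) : ℝ) : ℂ) = 1 := by
      rw [← Complex.ofReal_mul, ← Real.rpow_add hx]; simp
    push_cast at this ⊢
    field_simp
    linear_combination c * this
  · intro hpos
    have := (h0 hpos).sub ((tendsto_ofReal_rpow_zero hpos).const_mul (c / s))
    simpa using this

/-- If `x G'(x)` has a nonzero limit at zero then `|G|` tends to infinity. -/
theorem tendsto_cobounded_of_deriv {G G' : ℝ → ℂ} {c : ℂ} (hc : c ≠ 0)
    (hG : ∀ x : ℝ, 0 < x → HasDerivAt G (G' x) x)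
    (hG' : Tendsto (fun x : ℝ => (x : ℂ) * G' x) (𝓝[>] 0) (𝓝 c)) :
    Tendsto G (𝓝[>] 0) (Bornology.cobounded ℂ) := by
  rw [← tendsto_norm_atTop_iff_cobounded]
  have hc0 : 0 < ‖c‖ := norm_pos_iff.2 hc
  have h1 := (Metric.tendsto_nhds.1 hG') (‖c‖ / 2) (by positivity)
  obtain ⟨δ, hδ, hδb⟩ := (nhdsGT_basis (0 : ℝ)).eventually_iff.1 h1
  have hδb : ∀ t ∈ Ioo 0 δ, ‖(t : ℂ) * G' t - c‖ < ‖c‖ / 2 := fun t ht => by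
    have := hδb ht
    rwa [dist_eq_norm] at this
  set a := δ / 2 with ha
  have ha0 : 0 < a := by positivity
  -- The derivative of `G - c log` is at most `‖c‖ / (2 t)`, so `G` follows `c log` up to half its
  -- size.
  have key : ∀ x ∈ Ioo 0 a, ‖c‖ / 2 * (Real.log a - Real.log x) - ‖G a‖ ≤ ‖G x‖ := by
    intro x hx
    have h2 := norm_sub_le_of_norm_deriv_le_deriv (H := fun t => G t - c * ((Real.log t : ℝ) : ℂ))
      (H' := fun t => G' t - c * ((t⁻¹ : ℝ) : ℂ)) (B := fun t => ‖c‖ / 2 * Real.log t)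
      (B' := fun t => ‖c‖ / 2 * t⁻¹) hx.2.le
      (fun t ht => (hG t (lt_of_lt_of_le hx.1 ht.1)).sub
        ((Real.hasDerivAt_log (lt_of_lt_of_le hx.1 ht.1).ne').ofReal_comp.const_mul c))
      (fun t ht => (Real.hasDerivAt_log (lt_of_lt_of_le hx.1 ht.1).ne').const_mul _)
      (fun t ht => ?_)
    · have h3 : Real.log x ≤ Real.log a := Real.log_le_log hx.1 hx.2.le
      have h4 : c * (((Real.log a - Real.log x : ℝ)) : ℂ) =
          (G a - G x) - ((G a - c * ((Real.log a : ℝ) : ℂ)) - (G x - c * ((Real.log x : ℝ) : ℂ))) := by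
        push_cast; ring
      have h5 := norm_sub_le (G a - G x)
        ((G a - c * ((Real.log a : ℝ) : ℂ)) - (G x - c * ((Real.log x : ℝ) : ℂ)))
      rw [← h4, norm_mul, Complex.norm_real, Real.norm_of_nonneg (by linarith)] at h5
      have h6 := norm_sub_le (G a) (G x)
      linarith
    · have ht0 : 0 < t := lt_of_lt_of_le hx.1 ht.1
      have h3 := (hδb t ⟨ht0, by linarith [ht.2]⟩).le
      have h4 : G' t - c * ((t⁻¹ : ℝ) : ℂ) = ((t⁻¹ : ℝ) : ℂ) * ((t : ℂ) * G' t - c) := by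
        have : (t : ℂ) ≠ 0 := by exact_mod_cast ht0.ne'
        push_cast; field_simp
      rw [h4, norm_mul, Complex.norm_real, Real.norm_of_nonneg (by positivity), mul_comm]
      gcongr
  refine tendsto_atTop_mono' _ ?_ (f₁ := fun x => ‖c‖ / 2 * (Real.log a - Real.log x) - ‖G a‖) ?_
  · filter_upwards [Ioo_mem_nhdsGT ha0] with x hx using key x hx
  · refine tendsto_atTop_add_const_right _ _ (Tendsto.const_mul_atTop (by positivity) ?_)
    exact tendsto_atTop_add_const_left _ _ (tendsto_neg_atBot_atTop.comp Real.tendsto_log_nhdsGT_zero)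

/-! ### Behaviour at zero of a normalized solution and its derivative. -/

/-- `u(z, x) = O(x ^ r)` on `(0, 1]`, locally uniformly in `z`. -/
def PowerBounded (u : ℂ → ℝ → ℂ) (r : ℝ) : Prop :=
  ∀ R : ℝ, ∃ M : ℝ, ∀ z : ℂ, ‖z‖ ≤ R → ∀ x ∈ Ioc (0 : ℝ) 1, ‖u z x‖ ≤ M * x ^ r

/-- The condition on `s` is invariant under `s ↦ 1 - s`, so `t ^ (1 - s)` solves the unperturbed
equation and the term `l (l + 1) / t ^ 2` cancels in the Lagrange identity. -/
theorem wronskianAt_rpow_sub {l : ℝ} {q : ℝ → ℝ} {z : ℂ} {u : ℝ → ℂ} {s : ℝ}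
    (hs : s * (s - 1) = l * (l + 1)) (hu : IsBesselSolution l q z u) {a b : ℝ} (ha : 0 < a)
    (hab : a ≤ b) :
    ∫ t in a..b, ((t ^ (1 - s) : ℝ) : ℂ) * (((q t : ℂ) - z) * u t) =
      wronskianAt (fun t => ((t ^ (1 - s) : ℝ) : ℂ)) u b -
      wronskianAt (fun t => ((t ^ (1 - s) : ℝ) : ℂ)) u a := by
  set f : ℝ → ℂ := fun t => ((t ^ (1 - s) : ℝ) : ℂ) with hf
  have hpos : ∀ t ∈ uIcc a b, 0 < t := fun t ht => by
    rw [uIcc_of_le hab] at ht; exact lt_of_lt_of_le ha ht.1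
  have hf1 : ∀ t : ℝ, 0 < t → HasDerivAt f (((1 - s) * t ^ (-s) : ℝ) : ℂ) t := by
    intro t ht
    have := (Real.hasDerivAt_rpow_const (x := t) (p := 1 - s) (Or.inl ht.ne')).ofReal_comp
    simpa using this
  have hf2 : ∀ t : ℝ, 0 < t → HasDerivAt (deriv f) (((1 - s) * (-s * t ^ (-s - 1)) : ℝ) : ℂ) t := by
    intro t ht
    have := ((Real.hasDerivAt_rpow_const (x := t) (p := -s) (Or.inl ht.ne')).const_mul
      (1 - s)).ofReal_comp
    refine this.congr_of_eventuallyEq ?_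
    filter_upwards [Ioi_mem_nhds ht] with y hy using (hf1 y hy).deriv
  have hac : AbsolutelyContinuousOnInterval (deriv f) a b := by
    refine ContDiffOn.absolutelyContinuousOnInterval ?_
    have h1 : ContDiffOn ℝ 1 (fun t : ℝ => (((1 - s) * t ^ (-s) : ℝ) : ℂ)) (uIcc a b) := by
      intro t ht
      have h2 : ContDiffAt ℝ 1 (fun t : ℝ => (1 - s) * t ^ (-s)) t :=
        contDiffAt_const.mul (Real.contDiffAt_rpow_const_of_ne (hpos t ht).ne')
      exact (Complex.ofRealCLM.contDiff.contDiffAt.comp t h2).contDiffWithinAt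
    exact h1.congr fun t ht => (hf1 t (hpos t ht)).deriv
  rw [← (wronskianAt_sub (fun t ht => (hf1 t (hpos t ht)).differentiableAt) hac
      (fun t ht => hu.1 t (hpos t ht)) (hu.2.1 _ _ ha hab)).2]
  apply intervalIntegral.integral_congr_ae
  filter_upwards [hu.ae_deriv_deriv] with t h1 ht
  have h0 := hpos t (uIoc_subset_uIcc ht)
  rw [h1 h0, (hf2 t h0).deriv, besselPotential]
  have h3 : (1 - s) * (-s * t ^ (-s - 1)) = l * (l + 1) / t ^ 2 * t ^ (1 - s) := by
    have e : t ^ (1 - s) = t ^ (-s - 1) * t ^ 2 := by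
      rw [← Real.rpow_natCast t 2, ← Real.rpow_add h0]; norm_num; ring_nf
    rw [e, ← hs]
    field_simp
    ring
  rw [h3]
  push_cast
  simp only [hf]
  ring

section Normalized

variable {l : ℝ} {q : ℝ → ℝ} {c s : ℝ} {u : ℂ → ℝ → ℂ}

theorem exists_bound_of_continuousOn {v : ℂ → ℝ → ℂ}
    (hv : ContinuousOn (fun p : ℂ × ℝ => v p.1 p.2) (univ ×ˢ Icc (0 : ℝ) 1)) (R : ℝ) :
    ∃ M : ℝ, 0 ≤ M ∧ ∀ z : ℂ, ‖z‖ ≤ R → ∀ x ∈ Icc (0 : ℝ) 1, ‖v z x‖ ≤ M := by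
  obtain ⟨M, hM⟩ := ((isCompact_closedBall (0 : ℂ) R).prod (isCompact_Icc (a := (0 : ℝ)) (b := 1))
    ).exists_bound_of_continuousOn (hv.mono (prod_mono (subset_univ _) le_rfl))
  exact ⟨max M 0, le_max_right _ _, fun z hz x hx =>
    (hM (z, x) ⟨by simpa using hz, hx⟩).trans (le_max_left _ _)⟩

theorem IsNormalizedEntireSolution.powerBounded (hu : IsNormalizedEntireSolution l q c s u) :
    PowerBounded u s := by
  obtain ⟨v, hv, -, huv⟩ := hu.normalized
  intro R
  obtain ⟨M, hM0, hM⟩ := exists_bound_of_continuousOn hv R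
  refine ⟨|c| * M, fun z hz x hx => ?_⟩
  have hx0 := hx.1
  rw [huv z x hx, norm_mul, Complex.norm_real, norm_mul, Real.norm_eq_abs,
    Real.norm_of_nonneg (by positivity)]
  have := hM z hz x (Ioc_subset_Icc_self hx)
  calc |c| * x ^ s * ‖v z x‖ ≤ |c| * x ^ s * M := by gcongr
    _ = |c| * M * x ^ s := by ring

theorem IsNormalizedEntireSolution.tendsto (hu : IsNormalizedEntireSolution l q c s u) (z : ℂ) :
    Tendsto (fun x : ℝ => ((x ^ (-s) : ℝ) : ℂ) * u z x) (𝓝[>] 0) (𝓝 c) := by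
  obtain ⟨v, hv, hv0, huv⟩ := hu.normalized
  have h1 : ContinuousOn (fun x : ℝ => v z x) (Icc 0 1) :=
    hv.comp (f := fun x : ℝ => (z, x)) (by fun_prop) (fun x hx => ⟨mem_univ _, hx⟩)
  have h2 : Tendsto (fun x : ℝ => v z x) (𝓝[>] 0) (𝓝 1) := by
    have := h1 0 (by simp)
    rw [ContinuousWithinAt, hv0] at this
    refine this.mono_left ?_
    rw [← nhdsWithin_Ioc_eq_nhdsGT (zero_lt_one (α := ℝ))]
    exact nhdsWithin_mono _ Ioc_subset_Icc_self
  have h3 := h2.const_mul (c : ℂ)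
  rw [mul_one] at h3
  refine h3.congr' ?_
  filter_upwards [Ioc_mem_nhdsGT (zero_lt_one (α := ℝ))] with x hx
  have hx0 := hx.1
  have : ((x ^ (-s) : ℝ) : ℂ) * ((x ^ s : ℝ) : ℂ) = 1 := by
    rw [← Complex.ofReal_mul, ← Real.rpow_add hx0]; simp
  rw [huv z x hx]
  push_cast at this ⊢
  linear_combination (-(c : ℂ) * v z x) * this

/-- The Wronskian with `x ^ (1 - s)` is the primitive of an integrable function near zero. -/
theorem IsNormalizedEntireSolution.exists_integrable (hs : s * (s - 1) = l * (l + 1))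
    (hxq : IntegrableOn (fun x => x * q x) (Ioo 0 1)) (hu : IsNormalizedEntireSolution l q c s u) :
    ∃ g : ℂ → ℝ → ℂ, (∀ z, IntervalIntegrable (g z) volume 0 1) ∧
      (∀ R : ℝ, ∃ M : ℝ, ∀ z : ℂ, ‖z‖ ≤ R → ∀ x ∈ Icc (0 : ℝ) 1, ‖∫ t in (0 : ℝ)..x, g z t‖ ≤ M) ∧
      (∀ z : ℂ, ∀ x ∈ Ioc (0 : ℝ) 1, ∫ t in x..1, g z t =
        wronskianAt (fun t => ((t ^ (1 - s) : ℝ) : ℂ)) (u z) 1 -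
        wronskianAt (fun t => ((t ^ (1 - s) : ℝ) : ℂ)) (u z) x) := by
  obtain ⟨v, hv, hv0, huv⟩ := hu.normalized
  have hv1 : ∀ z, ContinuousOn (fun x : ℝ => v z x) (Icc 0 1) := fun z =>
    hv.comp (f := fun x : ℝ => (z, x)) (by fun_prop) (fun x hx => ⟨mem_univ _, hx⟩)
  have hq1 : IntegrableOn (fun x => x * q x) (Icc 0 1) := by
    rwa [integrableOn_Icc_iff_integrableOn_Ioo]
  have hq2 : ∀ z : ℂ, IntegrableOn (fun x : ℝ => (((x * q x : ℝ) : ℂ) - z * x)) (Icc 0 1) := by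
    intro z
    refine Integrable.sub hq1.ofReal ?_
    exact ContinuousOn.integrableOn_compact isCompact_Icc (by fun_prop)
  have hgint : ∀ z : ℂ, IntegrableOn
      (fun x : ℝ => (c * v z x) * (((x * q x : ℝ) : ℂ) - z * x)) (Icc 0 1) := fun z =>
    IntegrableOn.continuousOn_mul (continuousOn_const.mul (hv1 z)) (hq2 z) isCompact_Icc
  -- The powers `t ^ (1 - s)` and `t ^ s` combine to `t`, which turns `q` into the integrable `t q`,
  -- while `v` stays bounded up to zero.
  refine ⟨fun z x => (c * v z x) * (((x * q x : ℝ) : ℂ) - z * x), fun z => ?_, fun R => ?_,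
    fun z x hx => ?_⟩
  · rw [intervalIntegrable_iff_integrableOn_Icc_of_le zero_le_one]
    exact hgint z
  · obtain ⟨M, hM0, hM⟩ := exists_bound_of_continuousOn hv R
    refine ⟨∫ x in Icc (0 : ℝ) 1, (|c| * M) * (‖x * q x‖ + R), fun z hz x hx => ?_⟩
    have hR0 : 0 ≤ R := (norm_nonneg z).trans hz
    have hI : IntegrableOn (fun x => (|c| * M) * (‖x * q x‖ + R)) (Icc (0 : ℝ) 1) :=
      (hq1.norm.add (integrableOn_const (by simp))).const_mul _
    calc ‖∫ t in (0 : ℝ)..x, (c * v z t) * (((t * q t : ℝ) : ℂ) - z * t)‖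
        ≤ ∫ t in Ioc 0 x, ‖(c * v z t) * (((t * q t : ℝ) : ℂ) - z * t)‖ := by
          rw [intervalIntegral.integral_of_le hx.1]
          exact norm_integral_le_integral_norm _
      _ ≤ ∫ t in Ioc 0 x, (|c| * M) * (‖t * q t‖ + R) := by
          have hsub : Ioc 0 x ⊆ Icc (0 : ℝ) 1 := fun t ht => ⟨ht.1.le, ht.2.trans hx.2⟩
          refine setIntegral_mono_on ((hgint z).mono_set hsub).norm (hI.mono_set hsub)
            measurableSet_Ioc fun t ht => ?_
          have h1 := hM z hz t (hsub ht)
          have h2 := norm_sub_le (((t * q t : ℝ) : ℂ)) (z * t)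
          have h3 : ‖z * (t : ℂ)‖ ≤ R := by
            rw [norm_mul, Complex.norm_real, Real.norm_of_nonneg ht.1.le]
            have := (hsub ht).2
            nlinarith [norm_nonneg z, ht.1]
          rw [norm_mul, norm_mul, Complex.norm_real c, Real.norm_eq_abs]
          rw [Complex.norm_real] at h2
          gcongr
          linarith
      _ ≤ _ := by
          refine setIntegral_mono_set hI (ae_of_all _ fun t => ?_)
            (show Ioc 0 x ≤ Icc 0 1 from fun t ht => ⟨ht.1.le, ht.2.trans hx.2⟩).eventuallyLE
          simp only [Pi.zero_apply]
          positivity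
  · rw [← wronskianAt_rpow_sub hs (hu.solves z) hx.1 hx.2]
    refine intervalIntegral.integral_congr fun t ht => ?_
    rw [uIcc_of_le hx.2] at ht
    have ht0 : 0 < t := lt_of_lt_of_le hx.1 ht.1
    have : ((t ^ (1 - s) : ℝ) : ℂ) * ((t ^ s : ℝ) : ℂ) = t := by
      rw [← Complex.ofReal_mul, ← Real.rpow_add ht0]; simp
    simp only [huv z t ⟨ht0, ht.2⟩]
    push_cast at this ⊢
    linear_combination (-(c * v z t) * ((q t : ℂ) - z)) * this

theorem wronskianAt_rpow {f : ℝ → ℂ} {x : ℝ} (hx : 0 < x) :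
    wronskianAt (fun t => ((t ^ (1 - s) : ℝ) : ℂ)) f x =
      ((x ^ (1 - s) : ℝ) : ℂ) * deriv f x - (1 - s) * (((x ^ (-s) : ℝ) : ℂ) * f x) := by
  have := (Real.hasDerivAt_rpow_const (x := x) (p := 1 - s) (Or.inl hx.ne')).ofReal_comp
  rw [wronskianAt, this.deriv]
  have e : 1 - s - 1 = -s := by ring
  rw [e]
  push_cast
  ring

/-- The Wronskian with `x ^ (1 - s)` converges because its derivative is integrable; hence so does
`x ^ (1 - s) u'`. Its limit `m` must be `s c`, since otherwise integrating `u'` would contradict `u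
~ c x ^ s`. -/
theorem IsNormalizedEntireSolution.deriv_asymptotics (hs : s * (s - 1) = l * (l + 1))
    (hxq : IntegrableOn (fun x => x * q x) (Ioo 0 1)) (hu : IsNormalizedEntireSolution l q c s u) :
    (∀ z, Tendsto (fun x : ℝ => ((x ^ (1 - s) : ℝ) : ℂ) * deriv (u z) x) (𝓝[>] 0) (𝓝 (s * c))) ∧
    PowerBounded (fun z => deriv (u z)) (s - 1) := by
  obtain ⟨g, hgi, hgb, hgW⟩ := hu.exists_integrable hs hxq
  set W : ℂ → ℝ → ℂ := fun z => wronskianAt (fun t => ((t ^ (1 - s) : ℝ) : ℂ)) (u z) with hW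
  have hd : ∀ z (x : ℝ), 0 < x → ((x ^ (1 - s) : ℝ) : ℂ) * deriv (u z) x =
      W z x + (1 - s) * (((x ^ (-s) : ℝ) : ℂ) * u z x) := by
    intro z x hx
    simp only [hW]
    rw [wronskianAt_rpow hx]; ring
  have hWx : ∀ z, ∀ x ∈ Ioc (0 : ℝ) 1,
      W z x = (W z 1 - ∫ t in (0 : ℝ)..1, g z t) + ∫ t in (0 : ℝ)..x, g z t := by
    intro z x hx
    have hsub : ∀ a b : ℝ, a ∈ Icc (0 : ℝ) 1 → b ∈ Icc (0 : ℝ) 1 →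
        IntervalIntegrable (g z) volume a b := fun a b ha hb =>
      (hgi z).mono_set (by rw [uIcc_of_le (zero_le_one (α := ℝ))]; exact uIcc_subset_Icc ha hb)
    have h1 := intervalIntegral.integral_add_adjacent_intervals
      (hsub 0 x (by simp) (Ioc_subset_Icc_self hx)) (hsub x 1 (Ioc_subset_Icc_self hx) (by simp))
    have h2 := hgW z x hx
    rw [← h1, h2]
    ring
  have hint0 : ∀ z, Tendsto (fun x : ℝ => ∫ t in (0 : ℝ)..x, g z t) (𝓝[>] 0) (𝓝 0) := by
    intro z
    have hc : ContinuousOn (fun x => ∫ t in (0 : ℝ)..x, g z t) (uIcc 0 1) := by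
      apply intervalIntegral.continuousOn_primitive_interval
      rw [uIcc_of_le zero_le_one, ← intervalIntegrable_iff_integrableOn_Icc_of_le zero_le_one]
      exact hgi z
    rw [uIcc_of_le zero_le_one] at hc
    have := hc 0 (by simp)
    rw [ContinuousWithinAt, intervalIntegral.integral_same] at this
    refine this.mono_left ?_
    rw [← nhdsWithin_Ioc_eq_nhdsGT (zero_lt_one (α := ℝ))]
    exact nhdsWithin_mono _ Ioc_subset_Icc_self
  have hlim : ∀ z, ∃ m : ℂ,
      Tendsto (fun x : ℝ => ((x ^ (1 - s) : ℝ) : ℂ) * deriv (u z) x) (𝓝[>] 0) (𝓝 m) ∧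
      m = (W z 1 - ∫ t in (0 : ℝ)..1, g z t) + (1 - s) * c := by
    intro z
    refine ⟨_, ?_, rfl⟩
    have h1 := ((hint0 z).const_add (W z 1 - ∫ t in (0 : ℝ)..1, g z t)).add
      ((hu.tendsto z).const_mul (1 - s : ℂ))
    rw [add_zero] at h1
    refine h1.congr' ?_
    filter_upwards [Ioc_mem_nhdsGT (zero_lt_one (α := ℝ))] with x hx
    rw [hd z x hx.1, hWx z x hx]
  have hm : ∀ z m, Tendsto (fun x : ℝ => ((x ^ (1 - s) : ℝ) : ℂ) * deriv (u z) x) (𝓝[>] 0) (𝓝 m) →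
      m = s * c := by
    intro z m hm
    have hder : ∀ x : ℝ, 0 < x → HasDerivAt (u z) (deriv (u z) x) x :=
      fun x hx => ((hu.solves z).1 x hx).hasDerivAt
    rcases eq_or_ne s 0 with h0 | h0
    -- Here de l'Hospital is unavailable: a nonzero limit of `x u'` would make `u` diverge
    -- logarithmically, although it tends to `c`.
    · subst h0
      by_contra hne
      have hne' : m ≠ 0 := by simpa using hne
      have h1 := tendsto_cobounded_of_deriv (c := m) hne' hder (by simpa using hm)
      have h2 := hu.tendsto z
      simp only [neg_zero, Real.rpow_zero, Complex.ofReal_one, one_mul] at h2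
      exact (h2.not_tendsto (Metric.disjoint_nhds_cobounded _)) h1
    · have h1 := tendsto_rpow_mul_of_deriv h0 hder hm (fun hpos => ?_)
      · have h2 := tendsto_nhds_unique h1 (hu.tendsto z)
        have h3 : (s : ℂ) ≠ 0 := by exact_mod_cast h0
        rw [div_eq_iff h3] at h2
        rw [h2, mul_comm]
      · have h2 := (tendsto_ofReal_rpow_zero hpos).mul (hu.tendsto z)
        rw [zero_mul] at h2
        refine h2.congr' ?_
        filter_upwards [self_mem_nhdsWithin] with x hx
        have hx : 0 < x := hx
        rw [← mul_assoc, ← Complex.ofReal_mul, ← Real.rpow_add hx]; simp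
  refine ⟨fun z => ?_, fun R => ?_⟩
  · obtain ⟨m, h1, -⟩ := hlim z
    rwa [hm z m h1] at h1
  · obtain ⟨M₁, hM₁⟩ := hgb R
    obtain ⟨M₂, hM₂⟩ := hu.powerBounded R
    refine ⟨‖(s * c - (1 - s) * c : ℂ)‖ + M₁ + ‖(1 - s : ℂ)‖ * M₂, fun z hz x hx => ?_⟩
    have hx0 := hx.1
    obtain ⟨m, h1, h2⟩ := hlim z
    rw [hm z m h1] at h2
    have h3 := hd z x hx0
    -- Knowing the limit identifies the constant of integration, which a priori depends on `z`, as
    -- `s c - (1 - s) c`; this makes the bound uniform in `z`.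
    rw [hWx z x hx, show (W z 1 - ∫ t in (0 : ℝ)..1, g z t) = s * c - (1 - s) * c by
      linear_combination -h2] at h3
    have h4 := congrArg norm h3
    rw [norm_mul, Complex.norm_real, Real.norm_of_nonneg (by positivity)] at h4
    have h5 : ‖((x ^ (-s) : ℝ) : ℂ) * u z x‖ ≤ M₂ := by
      rw [norm_mul, Complex.norm_real, Real.norm_of_nonneg (by positivity), Real.rpow_neg hx0.le,
        inv_mul_le_iff₀ (by positivity), mul_comm]
      exact hM₂ z hz x hx
    have h6 : x ^ (1 - s) * ‖deriv (u z) x‖ ≤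
        ‖(s * c - (1 - s) * c : ℂ)‖ + M₁ + ‖(1 - s : ℂ)‖ * M₂ := by
      rw [h4]
      refine (norm_add_le _ _).trans (add_le_add ((norm_add_le _ _).trans (add_le_add le_rfl ?_)) ?_)
      · exact hM₁ z hz x (Ioc_subset_Icc_self hx)
      · rw [norm_mul]; gcongr
    have h7 : x ^ (1 - s) * x ^ (s - 1) = 1 := by
      rw [← Real.rpow_add hx0]; simp
    calc ‖deriv (u z) x‖ = (x ^ (1 - s) * ‖deriv (u z) x‖) * x ^ (s - 1) := by
          linear_combination (-‖deriv (u z) x‖) * h7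
      _ ≤ _ := by gcongr

end Normalized

/-! ### Calculus of power bounds and limits of Wronskians. -/

theorem ofReal_rpow_mul_rpow {x : ℝ} (hx : 0 < x) (a b : ℝ) :
    ((x ^ a : ℝ) : ℂ) * ((x ^ b : ℝ) : ℂ) = ((x ^ (a + b) : ℝ) : ℂ) := by
  rw [← Complex.ofReal_mul, ← Real.rpow_add hx]

theorem zDeriv_zero (u : ℂ → ℝ → ℂ) : zDeriv u 0 = u := by
  funext z x
  simp [zDeriv]

theorem PowerBounded.zDeriv {u : ℂ → ℝ → ℂ} {r : ℝ} (h : PowerBounded u r)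
    (hu : ∀ x : ℝ, 0 < x → Differentiable ℂ (fun z => u z x)) (k : ℕ) :
    PowerBounded (zDeriv u k) r := by
  intro R
  obtain ⟨M, hM⟩ := h (R + 1)
  refine ⟨k.factorial * M, fun z hz x hx => ?_⟩
  rw [mul_assoc]
  exact norm_iteratedDeriv_le_of_entire (hu x hx.1) (fun w hw => hM w hw x hx) k hz

theorem PowerBounded.eventuallyLocallyBounded {u : ℂ → ℝ → ℂ} {r : ℝ} (h : PowerBounded u r) :
    EventuallyLocallyBounded (𝓝[>] 0) (fun x z => ((x ^ (-r) : ℝ) : ℂ) * u z x) := by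
  intro R
  obtain ⟨M, hM⟩ := h R
  refine ⟨M, ?_⟩
  filter_upwards [Ioc_mem_nhdsGT (zero_lt_one (α := ℝ))] with x hx z hz
  have hx0 := hx.1
  rw [norm_mul, Complex.norm_real, Real.norm_of_nonneg (by positivity), Real.rpow_neg hx0.le,
    inv_mul_le_iff₀ (by positivity), mul_comm]
  exact hM z hz x hx

theorem PowerBounded.differentiable_lim {u : ℂ → ℝ → ℂ} {r : ℝ} {C : ℂ → ℂ} (h : PowerBounded u r)
    (hu : ∀ x : ℝ, 0 < x → Differentiable ℂ (fun z => u z x))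
    (hl : ∀ z, Tendsto (fun x : ℝ => ((x ^ (-r) : ℝ) : ℂ) * u z x) (𝓝[>] 0) (𝓝 (C z))) :
    Differentiable ℂ C := by
  refine h.eventuallyLocallyBounded.differentiable_lim ?_ hl
  filter_upwards [self_mem_nhdsWithin] with x hx using (hu x hx).const_mul _

theorem PowerBounded.tendsto_zDeriv {u : ℂ → ℝ → ℂ} {r : ℝ} {C : ℂ → ℂ} (h : PowerBounded u r)
    (hu : ∀ x : ℝ, 0 < x → Differentiable ℂ (fun z => u z x))
    (hl : ∀ z, Tendsto (fun x : ℝ => ((x ^ (-r) : ℝ) : ℂ) * u z x) (𝓝[>] 0) (𝓝 (C z)))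
    (k : ℕ) (z : ℂ) :
    Tendsto (fun x : ℝ => ((x ^ (-r) : ℝ) : ℂ) * _root_.zDeriv u k z x) (𝓝[>] 0)
      (𝓝 (iteratedDeriv k C z)) := by
  refine (h.eventuallyLocallyBounded.tendsto_iteratedDeriv ?_ hl k z).congr fun x => ?_
  · filter_upwards [self_mem_nhdsWithin] with x hx using (hu x hx).const_mul _
  · rw [iteratedDeriv_const_mul_field]; rfl

theorem PowerBounded.mono {u : ℂ → ℝ → ℂ} {r r' : ℝ} (h : PowerBounded u r) (hr : r' ≤ r) :
    PowerBounded u r' := by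
  intro R
  obtain ⟨M, hM⟩ := h R
  refine ⟨|M|, fun z hz x hx => (hM z hz x hx).trans ?_⟩
  have hx0 := hx.1
  calc M * x ^ r ≤ |M| * x ^ r := by gcongr; exact le_abs_self M
    _ ≤ |M| * x ^ r' := by
      gcongr |M| * ?_
      exact Real.rpow_le_rpow_of_exponent_ge hx.1 hx.2 hr

theorem PowerBounded.mul {u w : ℂ → ℝ → ℂ} {r r' : ℝ} (hu : PowerBounded u r)
    (hw : PowerBounded w r') : PowerBounded (fun z x => u z x * w z x) (r + r') := by
  intro R
  obtain ⟨M, hM⟩ := hu R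
  obtain ⟨M', hM'⟩ := hw R
  refine ⟨M * M', fun z hz x hx => ?_⟩
  have h1 := hM z hz x hx
  have h2 := hM' z hz x hx
  rw [norm_mul, Real.rpow_add hx.1]
  calc ‖u z x‖ * ‖w z x‖ ≤ (M * x ^ r) * (M' * x ^ r') :=
        mul_le_mul h1 h2 (norm_nonneg _) ((norm_nonneg _).trans h1)
    _ = _ := by ring

theorem PowerBounded.sub {u w : ℂ → ℝ → ℂ} {r : ℝ} (hu : PowerBounded u r)
    (hw : PowerBounded w r) : PowerBounded (fun z x => u z x - w z x) r := by
  intro R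
  obtain ⟨M, hM⟩ := hu R
  obtain ⟨M', hM'⟩ := hw R
  refine ⟨M + M', fun z hz x hx => (norm_sub_le _ _).trans ?_⟩
  rw [add_mul]
  exact add_le_add (hM z hz x hx) (hM' z hz x hx)

theorem PowerBounded.const_mul {u : ℂ → ℝ → ℂ} {r : ℝ} (hu : PowerBounded u r) (a : ℂ) :
    PowerBounded (fun z x => a * u z x) r := by
  intro R
  obtain ⟨M, hM⟩ := hu R
  refine ⟨‖a‖ * M, fun z hz x hx => ?_⟩
  rw [norm_mul, mul_assoc]
  exact mul_le_mul_of_nonneg_left (hM z hz x hx) (norm_nonneg a)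

theorem PowerBounded.congr {u w : ℂ → ℝ → ℂ} {r : ℝ} (hu : PowerBounded u r)
    (h : ∀ z, ∀ x : ℝ, 0 < x → w z x = u z x) : PowerBounded w r := by
  intro R
  obtain ⟨M, hM⟩ := hu R
  exact ⟨M, fun z hz x hx => by rw [h z x hx.1]; exact hM z hz x hx⟩

theorem PowerBounded.const_left {u : ℂ → ℝ → ℂ} {r : ℝ} (hu : PowerBounded u r) (z₀ : ℂ) :
    PowerBounded (fun _ => u z₀) r := by
  intro R
  obtain ⟨M, hM⟩ := hu ‖z₀‖
  exact ⟨M, fun _ _ x hx => hM z₀ le_rfl x hx⟩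

theorem PowerBounded.tendsto_zero {u : ℂ → ℝ → ℂ} {r a : ℝ} (hu : PowerBounded u r) (ha : 0 < a + r)
    (z : ℂ) : Tendsto (fun x : ℝ => ((x ^ a : ℝ) : ℂ) * u z x) (𝓝[>] 0) (𝓝 0) := by
  obtain ⟨M, hM⟩ := hu ‖z‖
  refine squeeze_zero_norm' (a := fun x => M * x ^ (a + r)) ?_
    (by simpa using (tendsto_rpow_zero ha).const_mul M)
  filter_upwards [Ioc_mem_nhdsGT (zero_lt_one (α := ℝ))] with x hx
  have hx0 := hx.1
  rw [norm_mul, Complex.norm_real, Real.norm_of_nonneg (by positivity), Real.rpow_add hx0]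
  have := hM z le_rfl x hx
  calc x ^ a * ‖u z x‖ ≤ x ^ a * (M * x ^ r) := by gcongr
    _ = _ := by ring

theorem tendsto_rpow_mul_wronskianAt {f g : ℝ → ℂ} {a b : ℝ} {A A' B B' : ℂ}
    (hf : Tendsto (fun x : ℝ => ((x ^ (-a) : ℝ) : ℂ) * f x) (𝓝[>] 0) (𝓝 A))
    (hf' : Tendsto (fun x : ℝ => ((x ^ (1 - a) : ℝ) : ℂ) * deriv f x) (𝓝[>] 0) (𝓝 A'))
    (hg : Tendsto (fun x : ℝ => ((x ^ (-b) : ℝ) : ℂ) * g x) (𝓝[>] 0) (𝓝 B))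
    (hg' : Tendsto (fun x : ℝ => ((x ^ (1 - b) : ℝ) : ℂ) * deriv g x) (𝓝[>] 0) (𝓝 B')) :
    Tendsto (fun x : ℝ => ((x ^ (1 - (a + b)) : ℝ) : ℂ) * wronskianAt f g x) (𝓝[>] 0)
      (𝓝 (A * B' - A' * B)) := by
  refine ((hf.mul hg').sub (hf'.mul hg)).congr' ?_
  filter_upwards [self_mem_nhdsWithin] with x hx
  have e1 := ofReal_rpow_mul_rpow hx (-a) (1 - b)
  have e2 := ofReal_rpow_mul_rpow hx (1 - a) (-b)
  rw [show -a + (1 - b) = 1 - (a + b) by ring] at e1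
  rw [show 1 - a + -b = 1 - (a + b) by ring] at e2
  rw [wronskianAt]
  linear_combination (f x * deriv g x) * e1 - (deriv f x * g x) * e2

theorem tendsto_wronskianAt_of_add_eq_one {f g : ℝ → ℂ} {a b : ℝ} {A : ℂ} (hab : a + b = 1)
    (h : Tendsto (fun x : ℝ => ((x ^ (1 - (a + b)) : ℝ) : ℂ) * wronskianAt f g x) (𝓝[>] 0) (𝓝 A)) :
    Tendsto (wronskianAt f g) (𝓝[>] 0) (𝓝 A) := by
  simpa [hab] using h

theorem tendsto_wronskianAt_zero {f g : ℝ → ℂ} {a b : ℝ} {A : ℂ} (hab : 1 < a + b)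
    (h : Tendsto (fun x : ℝ => ((x ^ (1 - (a + b)) : ℝ) : ℂ) * wronskianAt f g x) (𝓝[>] 0) (𝓝 A)) :
    Tendsto (wronskianAt f g) (𝓝[>] 0) (𝓝 0) := by
  have h1 := (tendsto_ofReal_rpow_zero (show 0 < a + b - 1 by linarith)).mul h
  rw [zero_mul] at h1
  refine h1.congr' ?_
  filter_upwards [self_mem_nhdsWithin] with x hx
  rw [← mul_assoc, ofReal_rpow_mul_rpow hx]
  simp

theorem wronskianAt_antisymm (f g : ℝ → ℂ) (x : ℝ) : wronskianAt f g x = -wronskianAt g f x := by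
  simp only [wronskianAt]; ring

/-- Leibniz' rule, where the affine factor leaves two terms. At `j = 0` the truncated index `j - 1`
is harmless, its coefficient being zero. -/
theorem iteratedDeriv_sub_mul {h : ℂ → ℂ} (hh : Differentiable ℂ h) (a : ℂ) (j : ℕ) (ζ : ℂ) :
    iteratedDeriv j (fun ζ => (a - ζ) * h ζ) ζ =
      (a - ζ) * iteratedDeriv j h ζ - j * iteratedDeriv (j - 1) h ζ := by
  induction j generalizing ζ with
  | zero => simp
  | succ j ih =>
    rw [iteratedDeriv_succ, show iteratedDeriv j (fun ζ => (a - ζ) * h ζ) = _ from funext ih]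
    have h1 : ∀ k, HasDerivAt (iteratedDeriv k h) (iteratedDeriv (k + 1) h ζ) ζ := fun k => by
      rw [iteratedDeriv_succ]
      exact (hh.iteratedDeriv_entire k ζ).hasDerivAt
    have h2 := (((hasDerivAt_id ζ).const_sub a).mul (h1 j)).sub ((h1 (j - 1)).const_mul (j : ℂ))
    refine Eq.trans (HasDerivAt.deriv (by exact h2)) ?_
    rcases j with _ | j
    · simp; ring
    · simp; ring

/-! ### Spectral derivatives of normalized solutions. -/

section Normalized

variable {l : ℝ} {q : ℝ → ℝ} {c s c' s' : ℝ} {u w : ℂ → ℝ → ℂ}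

theorem IsNormalizedEntireSolution.eventuallyLocallyBounded (hs : s * (s - 1) = l * (l + 1))
    (hq : LocallyIntegrableOn q (Ioi 0)) (hxq : IntegrableOn (fun x => x * q x) (Ioo 0 1))
    (hu : IsNormalizedEntireSolution l q c s u) {x : ℝ} (hx : 0 < x) :
    EventuallyLocallyBounded (𝓝 x) (fun y z => u z y) ∧
    EventuallyLocallyBounded (𝓝 x) (fun y z => deriv (u z) y) := by
  refine eventuallyLocallyBounded_solution hq hu.solves one_pos (fun R => ?_) hx
  obtain ⟨M₁, h₁⟩ := hu.powerBounded R
  obtain ⟨M₂, h₂⟩ := (hu.deriv_asymptotics hs hxq).2 R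
  refine ⟨M₁ + M₂, fun z hz => add_le_add ?_ ?_⟩
  · simpa using h₁ z hz 1 (by simp)
  · simpa using h₂ z hz 1 (by simp)

theorem IsNormalizedEntireSolution.hasDerivAt_zDeriv (hs : s * (s - 1) = l * (l + 1))
    (hq : LocallyIntegrableOn q (Ioi 0)) (hxq : IntegrableOn (fun x => x * q x) (Ioo 0 1))
    (hu : IsNormalizedEntireSolution l q c s u) {x : ℝ} (hx : 0 < x) :
    Differentiable ℂ (fun z => deriv (u z) x) ∧ ∀ (k : ℕ) (z : ℂ),
      HasDerivAt (zDeriv u k z) (zDeriv (fun z => deriv (u z)) k z x) x := by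
  refine hasDerivAt_iteratedDeriv (u' := fun z => deriv (u z)) ?_ ?_
    (hu.eventuallyLocallyBounded hs hq hxq hx).2
  · filter_upwards [Ioi_mem_nhds hx] with y hy using hu.entire y hy
  · filter_upwards [Ioi_mem_nhds hx] with y hy z using ((hu.solves z).1 y hy).hasDerivAt

theorem IsNormalizedEntireSolution.deriv_zDeriv (hs : s * (s - 1) = l * (l + 1))
    (hq : LocallyIntegrableOn q (Ioi 0)) (hxq : IntegrableOn (fun x => x * q x) (Ioo 0 1))
    (hu : IsNormalizedEntireSolution l q c s u) {x : ℝ} (hx : 0 < x) (k : ℕ) (z : ℂ) :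
    deriv (zDeriv u k z) x = zDeriv (fun z => deriv (u z)) k z x :=
  ((hu.hasDerivAt_zDeriv hs hq hxq hx).2 k z).deriv

/-- Differentiating `W' = (z - ζ) u w` in `ζ` replaces the inhomogeneous equation `τ w^(j) = ζ w^(j)
+ j w^(j-1)` and avoids second derivatives of `w^(j)` in `x`. -/
theorem IsNormalizedEntireSolution.hasDerivAt_wronskianAt_zDeriv (hs : s * (s - 1) = l * (l + 1))
    (hs' : s' * (s' - 1) = l * (l + 1))
    (hq : LocallyIntegrableOn q (Ioi 0)) (hxq : IntegrableOn (fun x => x * q x) (Ioo 0 1))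
    (hu : IsNormalizedEntireSolution l q c s u) (hw : IsNormalizedEntireSolution l q c' s' w)
    (z ζ : ℂ) (j : ℕ) {x : ℝ} (hx : 0 < x) :
    HasDerivAt (wronskianAt (u z) (zDeriv w j ζ))
      ((z - ζ) * (u z x * zDeriv w j ζ x) - j * (u z x * zDeriv w (j - 1) ζ x)) x := by
  have hw1 := fun {y : ℝ} (hy : 0 < y) => (hw.hasDerivAt_zDeriv hs' hq hxq hy)
  have h := (hasDerivAt_iteratedDeriv (x := x) (u := fun ζ => wronskianAt (u z) (w ζ))
    (u' := fun ζ y => (z - ζ) * (u z y * w ζ y)) ?_ ?_ ?_).2 j ζ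
  · have e : iteratedDeriv j (fun ζ => (z - ζ) * (u z x * w ζ x)) ζ =
        (z - ζ) * (u z x * zDeriv w j ζ x) - j * (u z x * zDeriv w (j - 1) ζ x) := by
      rw [iteratedDeriv_sub_mul ((hw.entire x hx).const_mul _), iteratedDeriv_const_mul_field,
        iteratedDeriv_const_mul_field]
      rfl
    rw [e] at h
    refine h.congr_of_eventuallyEq ?_
    filter_upwards [Ioi_mem_nhds hx] with y hy
    simp only [wronskianAt]
    rw [iteratedDeriv_fun_sub ((hw1 hy).1.const_mul _).contDiff.contDiffAt
      ((hw.entire y hy).const_mul _).contDiff.contDiffAt, iteratedDeriv_const_mul_field,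
      iteratedDeriv_const_mul_field, hw.deriv_zDeriv hs' hq hxq hy]
    rfl
  · filter_upwards [Ioi_mem_nhds hx] with y hy
    exact ((hw1 hy).1.const_mul _).sub ((hw.entire y hy).const_mul _)
  · filter_upwards [Ioi_mem_nhds hx] with y hy ζ
    exact (hu.solves z).hasDerivAt_wronskianAt (hw.solves ζ) hy
  · intro R
    obtain ⟨M₁, h₁⟩ := (hu.eventuallyLocallyBounded hs hq hxq hx).1 ‖z‖
    obtain ⟨M₂, h₂⟩ := (hw.eventuallyLocallyBounded hs' hq hxq hx).1 R
    refine ⟨(‖z‖ + R) * (M₁ * M₂), ?_⟩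
    filter_upwards [h₁, h₂] with y h₁ h₂ ζ hζ
    have a1 := h₁ z le_rfl
    have a2 := h₂ ζ hζ
    have a3 := norm_sub_le z ζ
    rw [norm_mul, norm_mul]
    have a4 : ‖u z y‖ * ‖w ζ y‖ ≤ M₁ * M₂ :=
      mul_le_mul a1 a2 (norm_nonneg _) ((norm_nonneg _).trans a1)
    exact mul_le_mul (by linarith) a4 (by positivity) (by linarith [norm_nonneg (z - ζ)])

theorem iteratedDeriv_const_entire (c : ℂ) (k : ℕ) (z : ℂ) :
    iteratedDeriv k (fun _ : ℂ => c) z = if k = 0 then c else 0 := by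
  simp [iteratedDeriv_const]

/-- The limit for `k = 0` does not depend on `z`, so its derivatives vanish. -/
theorem IsNormalizedEntireSolution.tendsto_zDeriv (hu : IsNormalizedEntireSolution l q c s u)
    (k : ℕ) (z : ℂ) : Tendsto (fun x : ℝ => ((x ^ (-s) : ℝ) : ℂ) * zDeriv u k z x) (𝓝[>] 0)
      (𝓝 (if k = 0 then (c : ℂ) else 0)) := by
  rw [← iteratedDeriv_const_entire (c : ℂ) k z]
  exact hu.powerBounded.tendsto_zDeriv hu.entire hu.tendsto k z

theorem IsNormalizedEntireSolution.tendsto_deriv_zDeriv (hs : s * (s - 1) = l * (l + 1))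
    (hq : LocallyIntegrableOn q (Ioi 0)) (hxq : IntegrableOn (fun x => x * q x) (Ioo 0 1))
    (hu : IsNormalizedEntireSolution l q c s u) (k : ℕ) (z : ℂ) :
    Tendsto (fun x : ℝ => ((x ^ (1 - s) : ℝ) : ℂ) * deriv (zDeriv u k z) x) (𝓝[>] 0)
      (𝓝 (if k = 0 then (s * c : ℂ) else 0)) := by
  rw [← iteratedDeriv_const_entire (s * c : ℂ) k z]
  have h := hu.deriv_asymptotics hs hxq
  have h1 := h.2.tendsto_zDeriv (C := fun _ => (s * c : ℂ))
    (fun x hx => (hu.hasDerivAt_zDeriv hs hq hxq hx).1) (by simpa using h.1) k z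
  refine h1.congr' ?_
  filter_upwards [self_mem_nhdsWithin] with x hx
  rw [hu.deriv_zDeriv hs hq hxq hx, neg_sub]

theorem IsNormalizedEntireSolution.powerBounded_zDeriv (hu : IsNormalizedEntireSolution l q c s u)
    (k : ℕ) : PowerBounded (zDeriv u k) s :=
  hu.powerBounded.zDeriv hu.entire k

theorem IsNormalizedEntireSolution.powerBounded_deriv_zDeriv (hs : s * (s - 1) = l * (l + 1))
    (hq : LocallyIntegrableOn q (Ioi 0)) (hxq : IntegrableOn (fun x => x * q x) (Ioo 0 1))
    (hu : IsNormalizedEntireSolution l q c s u) (k : ℕ) :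
    PowerBounded (fun z => deriv (zDeriv u k z)) (s - 1) :=
  ((hu.deriv_asymptotics hs hxq).2.zDeriv
    (fun _ hx => (hu.hasDerivAt_zDeriv hs hq hxq hx).1) k).congr
    fun z _ hx => hu.deriv_zDeriv hs hq hxq hx k z

/-- The limit of the Wronskians of the derivatives of two normalized solutions. -/
theorem IsNormalizedEntireSolution.tendsto_rpow_mul_wronskianAt_zDeriv
    (hs : s * (s - 1) = l * (l + 1)) (hs' : s' * (s' - 1) = l * (l + 1))
    (hq : LocallyIntegrableOn q (Ioi 0)) (hxq : IntegrableOn (fun x => x * q x) (Ioo 0 1))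
    (hu : IsNormalizedEntireSolution l q c s u) (hw : IsNormalizedEntireSolution l q c' s' w)
    (z ζ : ℂ) (i j : ℕ) :
    Tendsto (fun x : ℝ => ((x ^ (1 - (s + s')) : ℝ) : ℂ) *
      wronskianAt (zDeriv u i z) (zDeriv w j ζ) x) (𝓝[>] 0)
      (𝓝 (if i + j = 0 then ((s' - s) * (c * c') : ℂ) else 0)) := by
  have h := tendsto_rpow_mul_wronskianAt (hu.tendsto_zDeriv i z)
    (hu.tendsto_deriv_zDeriv hs hq hxq i z) (hw.tendsto_zDeriv j ζ)
    (hw.tendsto_deriv_zDeriv hs' hq hxq j ζ)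
  convert h using 2
  rcases i with _ | i <;> rcases j with _ | j <;> simp
  ring

end Normalized

/-! ### Integration of power bounds that are locally uniform in `z`. -/

section Integration

variable {G G' : ℂ → ℝ → ℂ} {s t : ℝ}

theorem PowerBounded.norm_sub_le (hG : ∀ z (x : ℝ), 0 < x → HasDerivAt (G z) (G' z x) x)
    (hG' : PowerBounded G' (s - 1)) (hs : s ≠ 0) (R : ℝ) :
    ∃ M : ℝ, ∀ z : ℂ, ‖z‖ ≤ R → ∀ x ≤ (1 : ℝ), ∀ y : ℝ, 0 < y → y ≤ x →
      ‖G z x - G z y‖ ≤ M / s * (x ^ s - y ^ s) := by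
  obtain ⟨M, hM⟩ := hG' R
  exact ⟨M, fun z hz x hx y hy hyx => norm_sub_le_of_norm_deriv_le_rpow hs hy hyx
    (fun t ht => hG z t (lt_of_lt_of_le hy ht.1))
    (fun t ht => hM z hz t ⟨lt_of_lt_of_le hy ht.1, ht.2.trans hx⟩)⟩

theorem PowerBounded.of_deriv_of_tendsto_zero
    (hG : ∀ z (x : ℝ), 0 < x → HasDerivAt (G z) (G' z x) x)
    (hG' : PowerBounded G' (s - 1)) (hs : 0 < s) (h0 : ∀ z, Tendsto (G z) (𝓝[>] 0) (𝓝 0)) :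
    PowerBounded G s := by
  intro R
  obtain ⟨M, hM⟩ := hG'.norm_sub_le hG hs.ne' R
  refine ⟨M / s, fun z hz x hx => ?_⟩
  have h5 : ‖G z x - 0‖ ≤ M / s * (x ^ s - 0) := by
    refine le_of_tendsto_of_tendsto (tendsto_const_nhds.sub (h0 z)).norm
      ((tendsto_const_nhds.sub (tendsto_rpow_zero hs)).const_mul (M / s)) ?_
    filter_upwards [Ioo_mem_nhdsGT hx.1] with y hy
    exact hM z hz x hx.2 y hy.1 hy.2.le
  simpa using h5

/-- Integration starts at `x = 1`, so the exponent `t` of the a priori bound is immaterial. Either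
`x ^ s` or the constant of integration dominates, whence the minimum. -/
theorem PowerBounded.of_deriv (hG : ∀ z (x : ℝ), 0 < x → HasDerivAt (G z) (G' z x) x)
    (hG' : PowerBounded G' (s - 1)) (hs : s ≠ 0) (hb : PowerBounded G t) :
    PowerBounded G (min s 0) := by
  intro R
  obtain ⟨M, hM⟩ := hG'.norm_sub_le hG hs R
  obtain ⟨M₁, hM₁⟩ := hb R
  refine ⟨|M₁| + |M| / |s|, fun z hz x hx => ?_⟩
  have hx0 := hx.1
  have h1 := hM z hz 1 le_rfl x hx.1 hx.2
  have h2 := hM₁ z hz 1 (by simp)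
  rw [Real.one_rpow, mul_one] at h2
  rw [Real.one_rpow] at h1
  have h3 : M / s * (1 - x ^ s) ≤ |M| / |s| * x ^ (min s 0) := by
    refine (le_abs_self _).trans ?_
    rw [abs_mul, abs_div]
    gcongr
    have hxs : 0 < x ^ s := by positivity
    rcases le_total s 0 with h | h
    · rw [min_eq_left h]
      have := Real.one_le_rpow_of_pos_of_le_one_of_nonpos hx.1 hx.2 h
      rw [abs_le]; constructor <;> linarith
    · rw [min_eq_right h, Real.rpow_zero]
      have := Real.rpow_le_one hx.1.le hx.2 h
      rw [abs_le]; constructor <;> linarith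
  have h4 : 1 ≤ x ^ (min s 0) :=
    Real.one_le_rpow_of_pos_of_le_one_of_nonpos hx.1 hx.2 (min_le_right _ _)
  have h5 : ‖G z x‖ ≤ ‖G z 1‖ + ‖G z 1 - G z x‖ := by
    have := _root_.norm_sub_le (G z 1) (G z 1 - G z x)
    rwa [sub_sub_cancel] at this
  have h6 : |M₁| ≤ |M₁| * x ^ (min s 0) := le_mul_of_one_le_right (abs_nonneg _) h4
  have h7 := le_abs_self M₁
  rw [add_mul]
  linarith

theorem PowerBounded.exists_tendsto (hG : ∀ z (x : ℝ), 0 < x → HasDerivAt (G z) (G' z x) x)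
    (hG' : PowerBounded G' (s - 1)) (hs : 0 < s) (z : ℂ) : ∃ L, Tendsto (G z) (𝓝[>] 0) (𝓝 L) := by
  obtain ⟨M, hM⟩ := hG'.norm_sub_le hG hs.ne' ‖z‖
  refine cauchy_map_iff_exists_tendsto.1 (Metric.cauchy_iff.2 ⟨inferInstance, fun ε hε => ?_⟩)
  have h1 : ∀ᶠ x in 𝓝[>] (0 : ℝ), |M| / s * x ^ s < ε := by
    have := (tendsto_rpow_zero hs).const_mul (|M| / s)
    rw [mul_zero] at this
    exact this.eventually_lt_const hε
  have key : ∀ x y : ℝ, y ≤ x → 0 < y → x ≤ 1 → |M| / s * x ^ s < ε → dist (G z x) (G z y) < ε := by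
    intro x y hyx hy hx h
    rw [dist_eq_norm]
    refine (hM z le_rfl x hx y hy hyx).trans_lt (lt_of_le_of_lt ?_ h)
    have h2 : y ^ s ≤ x ^ s := by gcongr
    have h3 : 0 ≤ y ^ s := by positivity
    calc M / s * (x ^ s - y ^ s) ≤ |M| / s * (x ^ s - y ^ s) := by
          gcongr
          exact le_abs_self M
      _ ≤ |M| / s * x ^ s := by gcongr; linarith
  refine ⟨_, image_mem_map (inter_mem h1 (Ioc_mem_nhdsGT (zero_lt_one (α := ℝ)))), ?_⟩
  rintro _ ⟨x, ⟨hx, hx1⟩, rfl⟩ _ ⟨y, ⟨hy, hy1⟩, rfl⟩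
  rcases le_total x y with h | h
  · rw [dist_comm]; exact key y x h hx1.1 hy1.2 hy
  · exact key x y h hy1.1 hx1.2 hx

end Integration

/-! ### Variation of constants and growth of the spectral derivatives of `θ`. -/

/-- A pair of normalized entire solutions of the perturbed Bessel equation. -/
structure IsBesselPair (l : ℝ) (q : ℝ → ℝ) (φ θ : ℂ → ℝ → ℂ) : Prop where
  lt : -1 / 2 < l
  locallyIntegrable : LocallyIntegrableOn q (Ioi 0)
  integrable : IntegrableOn (fun x => x * q x) (Ioo 0 1)
  regular : IsNormalizedEntireSolution l q 1 (l + 1) φ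
  singular : IsNormalizedEntireSolution l q (1 / (2 * l + 1)) (-l) θ

namespace IsBesselPair

variable {l : ℝ} {q : ℝ → ℝ} {φ θ : ℂ → ℝ → ℂ}

theorem exponent_regular (l : ℝ) : (l + 1) * (l + 1 - 1) = l * (l + 1) := by ring

theorem exponent_singular (l : ℝ) : -l * (-l - 1) = l * (l + 1) := by ring

theorem pos (h : IsBesselPair l q φ θ) : 0 < 2 * l + 1 := by linarith [h.lt]

theorem ne_zero (h : IsBesselPair l q φ θ) : (2 * l + 1 : ℂ) ≠ 0 := by
  have := h.pos.ne'
  exact_mod_cast this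

theorem tendsto_wronskianAt_singular_regular (h : IsBesselPair l q φ θ) (z ζ : ℂ) (i j : ℕ) :
    Tendsto (wronskianAt (zDeriv θ i z) (zDeriv φ j ζ)) (𝓝[>] 0)
      (𝓝 (if i + j = 0 then 1 else 0)) := by
  refine tendsto_wronskianAt_of_add_eq_one (a := -l) (b := l + 1) (by ring) ?_
  have := h.singular.tendsto_rpow_mul_wronskianAt_zDeriv (exponent_singular l) (exponent_regular l)
    h.locallyIntegrable h.integrable h.regular z ζ i j
  convert this using 3
  have := h.ne_zero
  have e : ((l + 1 : ℝ) - (-l : ℝ) : ℂ) = 2 * l + 1 := by push_cast; ring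
  rw [e]
  push_cast
  field_simp

theorem tendsto_wronskianAt_regular (h : IsBesselPair l q φ θ) (z ζ : ℂ) (i j : ℕ) :
    Tendsto (wronskianAt (zDeriv φ i z) (zDeriv φ j ζ)) (𝓝[>] 0) (𝓝 0) :=
  tendsto_wronskianAt_zero (by linarith [h.pos])
    (h.regular.tendsto_rpow_mul_wronskianAt_zDeriv (exponent_regular l) (exponent_regular l)
      h.locallyIntegrable h.integrable h.regular z ζ i j)

theorem wronskianAt_eq_one (h : IsBesselPair l q φ θ) (z : ℂ) {x : ℝ} (hx : 0 < x) :
    wronskianAt (θ z) (φ z) x = 1 := by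
  have h1 := h.tendsto_wronskianAt_singular_regular z z 0 0
  rw [zDeriv_zero, zDeriv_zero] at h1
  refine tendsto_nhds_unique (f := fun _ : ℝ => wronskianAt (θ z) (φ z) x) tendsto_const_nhds
    (h1.congr' ?_)
  filter_upwards [Ioo_mem_nhdsGT hx] with y hy
  have h2 := norm_sub_le_of_norm_deriv_le_deriv (B := fun _ => 0) (B' := fun _ => 0) hy.2.le
    (fun t ht => (h.singular.solves z).hasDerivAt_wronskianAt (h.regular.solves z)
      (lt_of_lt_of_le hy.1 ht.1)) (fun t _ => hasDerivAt_const t 0) (fun t _ => by simp)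
  have h3 := norm_le_zero_iff.1 (h2.trans (by simp))
  exact (sub_eq_zero.1 h3).symm

/-- Cramer's rule for the pair `θ`, `φ` of Wronskian one: variation of constants, valid pointwise
for any `g`. -/
theorem eq_wronskianAt (h : IsBesselPair l q φ θ) (z : ℂ) {x : ℝ} (hx : 0 < x) (g : ℝ → ℂ) :
    g x = wronskianAt (θ z) g x * φ z x - wronskianAt (φ z) g x * θ z x := by
  have h1 := h.wronskianAt_eq_one z hx
  simp only [wronskianAt] at h1 ⊢
  linear_combination (-g x) * h1

theorem deriv_eq_wronskianAt (h : IsBesselPair l q φ θ) (z : ℂ) {x : ℝ} (hx : 0 < x) (g : ℝ → ℂ) :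
    deriv g x = wronskianAt (θ z) g x * deriv (φ z) x - wronskianAt (φ z) g x * deriv (θ z) x := by
  have h1 := h.wronskianAt_eq_one z hx
  simp only [wronskianAt] at h1 ⊢
  linear_combination (-deriv g x) * h1

theorem hasDerivAt_wronskianAt_singular (h : IsBesselPair l q φ θ) (k : ℕ) (z ζ : ℂ) {x : ℝ}
    (hx : 0 < x) : HasDerivAt (wronskianAt (θ z) (zDeriv θ k ζ))
      ((z - ζ) * (θ z x * zDeriv θ k ζ x) - k * (θ z x * zDeriv θ (k - 1) ζ x)) x :=
  h.singular.hasDerivAt_wronskianAt_zDeriv (exponent_singular l) (exponent_singular l)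
    h.locallyIntegrable h.integrable h.singular z ζ k hx

theorem hasDerivAt_wronskianAt_singular_self (h : IsBesselPair l q φ θ) (k : ℕ) (z : ℂ) {x : ℝ}
    (hx : 0 < x) : HasDerivAt (wronskianAt (θ z) (zDeriv θ k z))
      (-k * (θ z x * zDeriv θ (k - 1) z x)) x := by
  have := h.hasDerivAt_wronskianAt_singular k z z hx
  convert this using 1
  ring

theorem hasDerivAt_wronskianAt_regular_self (h : IsBesselPair l q φ θ) (k : ℕ) (z : ℂ) {x : ℝ}
    (hx : 0 < x) : HasDerivAt (wronskianAt (φ z) (zDeriv θ k z))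
      (-k * (φ z x * zDeriv θ (k - 1) z x)) x := by
  have := h.regular.hasDerivAt_wronskianAt_zDeriv (exponent_regular l) (exponent_singular l)
    h.locallyIntegrable h.integrable h.singular z z k hx
  convert this using 1
  ring

theorem tendsto_wronskianAt_regular_self (h : IsBesselPair l q φ θ) {k : ℕ} (hk : k ≠ 0) (z : ℂ) :
    Tendsto (wronskianAt (φ z) (zDeriv θ k z)) (𝓝[>] 0) (𝓝 0) := by
  have h1 := (h.tendsto_wronskianAt_singular_regular z z k 0).neg
  rw [zDeriv_zero, if_neg (by omega), neg_zero] at h1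
  refine h1.congr fun x => ?_
  rw [wronskianAt_antisymm (φ z)]

theorem powerBounded_regular (h : IsBesselPair l q φ θ) : PowerBounded φ (l + 1) :=
  h.regular.powerBounded

theorem powerBounded_singular (h : IsBesselPair l q φ θ) : PowerBounded θ (-l) :=
  h.singular.powerBounded

theorem powerBounded_deriv_regular (h : IsBesselPair l q φ θ) :
    PowerBounded (fun z => deriv (φ z)) l := by
  simpa using (h.regular.deriv_asymptotics (exponent_regular l) h.integrable).2

theorem powerBounded_deriv_singular (h : IsBesselPair l q φ θ) :
    PowerBounded (fun z => deriv (θ z)) (-l - 1) :=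
  (h.singular.deriv_asymptotics (exponent_singular l) h.integrable).2

theorem powerBounded_wronskianAt_regular (h : IsBesselPair l q φ θ) {k : ℕ} (hk : k ≠ 0) {r : ℝ}
    (hr : 0 < r + l) (hf : PowerBounded (zDeriv θ (k - 1)) (r - 2)) :
    PowerBounded (fun z => wronskianAt (φ z) (zDeriv θ k z)) (l + r) := by
  refine PowerBounded.of_deriv_of_tendsto_zero
    (fun z x hx => h.hasDerivAt_wronskianAt_regular_self k z hx) ?_ (by linarith)
    (fun z => h.tendsto_wronskianAt_regular_self hk z)
  have := (h.powerBounded_regular.mul hf).const_mul (-k)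
  rwa [show l + 1 + (r - 2) = l + r - 1 by ring] at this

theorem powerBounded_deriv_wronskianAt_singular (h : IsBesselPair l q φ θ) {k : ℕ} {r : ℝ}
    (hf : PowerBounded (zDeriv θ (k - 1)) (r - 2)) :
    PowerBounded (fun z x => -k * (θ z x * zDeriv θ (k - 1) z x)) (r - l - 1 - 1) := by
  have := (h.powerBounded_singular.mul hf).const_mul (-k)
  rwa [show -l + (r - 2) = r - l - 1 - 1 by ring] at this

theorem powerBounded_wronskianAt_singular (h : IsBesselPair l q φ θ) {k : ℕ} {r : ℝ}
    (hr : r - l - 1 ≠ 0) (hf : PowerBounded (zDeriv θ (k - 1)) (r - 2)) :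
    PowerBounded (fun z => wronskianAt (θ z) (zDeriv θ k z)) (min (r - l - 1) 0) := by
  refine PowerBounded.of_deriv (t := -l + (-l - 1))
    (fun z x hx => h.hasDerivAt_wronskianAt_singular_self k z hx)
    (h.powerBounded_deriv_wronskianAt_singular hf) hr ?_
  have h1 := h.powerBounded_singular.mul (h.singular.powerBounded_deriv_zDeriv
    (exponent_singular l) h.locallyIntegrable h.integrable k)
  have h2 := h.powerBounded_deriv_singular.mul (h.singular.powerBounded_zDeriv k)
  rw [add_comm (-l - 1)] at h2
  exact h1.sub h2

/-- The exponents of the solution of the inhomogeneous equation: one gains `x ^ 2`, unless this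
exceeds the exponent `l + 1` of the regular solution. -/
theorem powerBounded_step (h : IsBesselPair l q φ θ) {k : ℕ} (hk : k ≠ 0) {r : ℝ}
    (hr : 0 < r + l) (hr' : r - l - 1 ≠ 0) (hf : PowerBounded (zDeriv θ (k - 1)) (r - 2)) :
    PowerBounded (zDeriv θ k) (min r (l + 1)) ∧
    PowerBounded (fun z => deriv (zDeriv θ k z)) (min r (l + 1) - 1) := by
  have h1 := h.powerBounded_wronskianAt_singular hr' hf
  have h2 := h.powerBounded_wronskianAt_regular hk hr hf
  -- Multiplication by `φ` adds `l + 1`, so the `φ` part has exponent `min r (l + 1)`. The `θ` part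
  -- has exponent `r`.
  have e : min (r - l - 1) 0 = min r (l + 1) - (l + 1) := by
    rw [← min_sub_sub_right]; ring_nf
  rw [e] at h1
  have hmin := min_le_left r (l + 1)
  constructor
  · refine (((h1.mul h.powerBounded_regular).mono (r' := min r (l + 1)) (by linarith)).sub
      ((h2.mul h.powerBounded_singular).mono (r' := min r (l + 1)) (by linarith))).congr
      fun z x hx => h.eq_wronskianAt z hx _
  · refine (((h1.mul h.powerBounded_deriv_regular).mono (r' := min r (l + 1) - 1)
      (by linarith)).sub ((h2.mul h.powerBounded_deriv_singular).mono
      (r' := min r (l + 1) - 1) (by linarith))).congr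
      fun z x hx => h.deriv_eq_wronskianAt z hx _

theorem nBessel_le (h : IsBesselPair l q φ θ) : (nBessel l : ℝ) ≤ l + 1 / 2 :=
  Nat.floor_le (by linarith [h.lt])

theorem lt_nBessel (l : ℝ) : l + 1 / 2 < nBessel l + 1 :=
  Nat.lt_floor_add_one _

/-- A small loss in the exponents, which takes care of the logarithmic terms. -/
noncomputable def loss (l : ℝ) : ℝ := (nBessel l + 1 - (l + 1 / 2)) / 2

theorem loss_pos (l : ℝ) : 0 < loss l := by
  have := lt_nBessel l
  rw [loss]; linarith

theorem loss_le (h : IsBesselPair l q φ θ) : loss l ≤ 1 / 2 := by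
  have := h.nBessel_le
  rw [loss]; linarith

/-- Subtracting `loss l` keeps the exponent strictly below `l + 1`, so `powerBounded_step` never
meets its excluded value, even when `2 * nBessel l = 2 * l + 1` and a logarithm occurs. -/
theorem powerBounded_singular_zDeriv (h : IsBesselPair l q φ θ) {k : ℕ} (hk : k ≤ nBessel l) :
    PowerBounded (zDeriv θ k) (-l + 2 * k - loss l) ∧
    PowerBounded (fun z => deriv (zDeriv θ k z)) (-l + 2 * k - loss l - 1) := by
  have hε := loss_pos l
  have hε' := h.loss_le
  induction k with
  | zero =>
    rw [zDeriv_zero]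
    exact ⟨h.powerBounded_singular.mono (by simp; linarith),
      h.powerBounded_deriv_singular.mono (by simp; linarith)⟩
  | succ k ih =>
    have h1 := (ih (by omega)).1
    have h2 : ((k + 1 : ℕ) : ℝ) ≤ l + 1 / 2 := le_trans (by exact_mod_cast hk) h.nBessel_le
    have h3 : (0 : ℝ) ≤ k := Nat.cast_nonneg k
    push_cast at h2 ⊢
    have h4 := h.powerBounded_step (k := k + 1) (by omega) (r := -l + 2 * (k + 1) - loss l)
      (by linarith) (by linarith) (by
        rw [show -l + 2 * ((k : ℝ) + 1) - loss l - 2 = -l + 2 * k - loss l by ring]; exact h1)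
    rwa [min_eq_left (by linarith)] at h4

/-- Since `2 (n_l + 1) - (2 l + 1)` equals four times `loss l`, the new exponent exceeds `l + 1` by
three times `loss l`, and the minimum switches to `l + 1`. -/
theorem powerBounded_singular_zDeriv_succ (h : IsBesselPair l q φ θ) :
    PowerBounded (zDeriv θ (nBessel l + 1)) (l + 1) ∧
    PowerBounded (fun z => deriv (zDeriv θ (nBessel l + 1) z)) l := by
  have hε := loss_pos l
  have h1 := (h.powerBounded_singular_zDeriv le_rfl).1
  have h0 : (0 : ℝ) ≤ nBessel l := Nat.cast_nonneg _
  have hε' := h.loss_le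
  have h5 : loss l = (nBessel l + 1 - (l + 1 / 2)) / 2 := rfl
  have h4 := h.powerBounded_step (k := nBessel l + 1) (by omega)
    (r := -l + 2 * (nBessel l + 1) - loss l) (by linarith) (by linarith)
    (by
      rw [show -l + 2 * ((nBessel l : ℝ) + 1) - loss l - 2 = -l + 2 * nBessel l - loss l by ring]
      exact h1)
  rw [min_eq_right (by linarith)] at h4
  simpa using h4

/-- `W(θ, θ^(n_l+1))` has an integrable derivative, hence a limit `L`, which multiplies `φ`. The
other coefficient is `o(x ^ (2 l + 1))`, so the part along `θ` is `o(x ^ (l + 1))`. -/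
theorem exists_tendsto_singular_zDeriv (h : IsBesselPair l q φ θ) (z : ℂ) :
    ∃ L : ℂ,
      Tendsto (fun x : ℝ => ((x ^ (-(l + 1)) : ℝ) : ℂ) * zDeriv θ (nBessel l + 1) z x)
        (𝓝[>] 0) (𝓝 L) ∧
      Tendsto (fun x : ℝ => ((x ^ (-l) : ℝ) : ℂ) * deriv (zDeriv θ (nBessel l + 1) z) x)
        (𝓝[>] 0) (𝓝 ((l + 1) * L)) := by
  have hε := loss_pos l
  have h1 := (h.powerBounded_singular_zDeriv le_rfl).1
  have h0 : (0 : ℝ) ≤ nBessel l := Nat.cast_nonneg _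
  have hε' := h.loss_le
  have h5 : loss l = (nBessel l + 1 - (l + 1 / 2)) / 2 := rfl
  set n := nBessel l with hn
  set r : ℝ := -l + 2 * (n + 1) - loss l with hr
  have h1 : PowerBounded (zDeriv θ (n + 1 - 1)) (r - 2) := by
    rw [show r - 2 = -l + 2 * n - loss l by rw [hr]; ring]; exact h1
  obtain ⟨L, hL⟩ := PowerBounded.exists_tendsto
    (fun z x hx => h.hasDerivAt_wronskianAt_singular_self (n + 1) z hx)
    (h.powerBounded_deriv_wronskianAt_singular h1) (by linarith) z
  have h2 := h.powerBounded_wronskianAt_regular (by omega) (by linarith) h1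
  have hW := h2.tendsto_zero (a := -(2 * l + 1)) (by linarith) z
  refine ⟨L, ?_, ?_⟩
  · have h3 := (hL.mul (h.regular.tendsto z)).sub (hW.mul (h.singular.tendsto z))
    simp only [zero_mul, sub_zero, Complex.ofReal_one, mul_one] at h3
    refine h3.congr' ?_
    filter_upwards [self_mem_nhdsWithin] with x hx
    have e := ofReal_rpow_mul_rpow hx (-(2 * l + 1)) (- -l)
    rw [show -(2 * l + 1) + - -l = -(l + 1) by ring] at e
    rw [h.eq_wronskianAt z hx (zDeriv θ (n + 1) z)]
    linear_combination (-(wronskianAt (φ z) (zDeriv θ (n + 1) z) x * θ z x)) * e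
  · have h3 := (hL.mul ((h.regular.deriv_asymptotics (exponent_regular l) h.integrable).1 z)).sub
      (hW.mul ((h.singular.deriv_asymptotics (exponent_singular l) h.integrable).1 z))
    have h4 : L * (((l + 1 : ℝ) : ℂ) * ((1 : ℝ) : ℂ)) -
        0 * (((-l : ℝ) : ℂ) * ((1 / (2 * l + 1) : ℝ) : ℂ)) = (l + 1) * L := by
      push_cast; ring
    rw [h4] at h3
    refine h3.congr' ?_
    filter_upwards [self_mem_nhdsWithin] with x hx
    have e := ofReal_rpow_mul_rpow hx (-(2 * l + 1)) (1 - -l)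
    rw [show -(2 * l + 1) + (1 - -l) = -l by ring] at e
    rw [h.deriv_eq_wronskianAt z hx (zDeriv θ (n + 1) z), show 1 - (l + 1) = -l by ring]
    linear_combination (-(wronskianAt (φ z) (zDeriv θ (n + 1) z) x * deriv (θ z) x)) * e

theorem cTheta_succ {l : ℝ} {k : ℕ} :
    cTheta l (k + 1) = cTheta l k / (2 * (2 * l + 1 - 2 * (k + 1 : ℕ))) := by
  have h1 : (ascPochhammer ℝ (k + 1)).eval (l - (k + 1 : ℕ) + 1 / 2) =
      (l - (k + 1 : ℕ) + 1 / 2) * (ascPochhammer ℝ k).eval (l - k + 1 / 2) := by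
    rw [ascPochhammer_succ_left]
    simp only [Polynomial.eval_mul, Polynomial.eval_X, Polynomial.eval_comp, Polynomial.eval_add,
      Polynomial.eval_one]
    congr 2
    push_cast; ring
  rw [cTheta, cTheta, h1, div_div]
  congr 1
  push_cast
  ring

theorem cTheta_ne_zero {l : ℝ} {k : ℕ} (hk : (2 * k : ℝ) < 2 * l + 1) : cTheta l k ≠ 0 := by
  have := ascPochhammer_pos k (l - k + 1 / 2 : ℝ) (by linarith)
  rw [cTheta]
  positivity

/-- Here `p = 2 l + 1`, `K = k + 1`, `D = p - 2 K`; the two terms are the `φ` and `θ` parts of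
variation of constants, and the result matches `cTheta_succ`. -/
theorem coefficient_recursion {p K D C : ℂ} (hp : p ≠ 0) (hD : D ≠ 0) (hK : K ≠ 0)
    (e : p = D + 2 * K) :
    -K * (1 / p * (C / p)) / -D - -K * (C / p) / (2 * K) * (1 / p) = C / (2 * D) / p := by
  field_simp
  linear_combination (-C) * e

theorem coefficient_recursion_deriv {l p K D C : ℂ} (hp : p ≠ 0) (hD : D ≠ 0) (hK : K ≠ 0)
    (e : p = D + 2 * K) (e' : p = 2 * l + 1) :
    -K * (1 / p * (C / p)) / -D * (l + 1) - -K * (C / p) / (2 * K) * (-l * (1 / p)) =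
      (-l + 2 * K) * (C / (2 * D) / p) := by
  field_simp
  subst e
  obtain rfl : D = 2 * l + 1 - 2 * K := by linear_combination e'
  ring

/-- The leading asymptotics of `∂_z^k θ(z, x)`, as long as its exponent `2 k - l` is less than the
exponent `l + 1` of the regular solution. -/
theorem tendsto_singular_zDeriv (h : IsBesselPair l q φ θ) {k : ℕ} (hk : (2 * k : ℝ) < 2 * l + 1)
    (z : ℂ) :
    Tendsto (fun x : ℝ => ((x ^ (-(-l + 2 * k)) : ℝ) : ℂ) * zDeriv θ k z x) (𝓝[>] 0)
      (𝓝 ((cTheta l k / (2 * l + 1) : ℝ) : ℂ)) ∧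
    Tendsto (fun x : ℝ => ((x ^ (1 - (-l + 2 * k)) : ℝ) : ℂ) * deriv (zDeriv θ k z) x) (𝓝[>] 0)
      (𝓝 (((-l + 2 * k) * (cTheta l k / (2 * l + 1)) : ℝ) : ℂ)) := by
  have hp := h.pos
  have hpC := h.ne_zero
  induction k with
  | zero =>
    have h1 := h.singular.tendsto z
    have h2 := (h.singular.deriv_asymptotics (exponent_singular l) h.integrable).1 z
    rw [zDeriv_zero]
    simp only [Nat.cast_zero, mul_zero, add_zero]
    refine ⟨by simpa [cTheta] using h1, by simpa [cTheta] using h2⟩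
  | succ k ih =>
    obtain ⟨ih, -⟩ := ih (by push_cast at hk; linarith)
    set K : ℝ := ((k + 1 : ℕ) : ℝ) with hK
    have hKk : K = k + 1 := by simp [hK]
    have hK0 : 0 < K := by positivity
    have hKC : (K : ℂ) ≠ 0 := by exact_mod_cast hK0.ne'
    have hs : 2 * K - (2 * l + 1) < 0 := by linarith
    have hsC : (2 * K - (2 * l + 1) : ℂ) ≠ 0 := by exact_mod_cast hs.ne
    have hsC' : ((2 * l + 1) - 2 * K : ℂ) ≠ 0 := by
      rw [← neg_sub]; exact neg_ne_zero.2 hsC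
    -- `A1` and `A2` give the coefficients of `θ` and `φ`, of orders `x ^ (2 K)` and `x ^ (2 K - (2
    -- l + 1))`. The first exponent is positive and needs vanishing at zero; the second is negative
    -- and needs no boundary condition.
    have A1 := tendsto_rpow_mul_of_deriv (s := 2 * K)
      (c := -K * (1 * ((cTheta l k / (2 * l + 1) : ℝ) : ℂ))) (by positivity)
      (fun x hx => h.hasDerivAt_wronskianAt_regular_self (k + 1) z hx) ?_
      (fun _ => h.tendsto_wronskianAt_regular_self (by omega) z)
    · have A2 := tendsto_rpow_mul_of_deriv (s := 2 * K - (2 * l + 1))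
        (c := -K * (((1 / (2 * l + 1) : ℝ) : ℂ) * ((cTheta l k / (2 * l + 1) : ℝ) : ℂ))) hs.ne
        (fun x hx => h.hasDerivAt_wronskianAt_singular_self (k + 1) z hx) ?_
        (fun hpos => absurd hpos hs.not_gt)
      · constructor
        · have h3 := (A2.mul (h.regular.tendsto z)).sub (A1.mul (h.singular.tendsto z))
          refine (h3.congr' ?_).trans_eq ?_
          · filter_upwards [self_mem_nhdsWithin] with x hx
            have e1 := ofReal_rpow_mul_rpow hx (-(2 * K - (2 * l + 1))) (-(l + 1))
            have e2 := ofReal_rpow_mul_rpow hx (-(2 * K)) (- -l)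
            rw [show -(2 * K - (2 * l + 1)) + -(l + 1) = -(-l + 2 * K) by ring] at e1
            rw [show -(2 * K) + - -l = -(-l + 2 * K) by ring] at e2
            rw [h.eq_wronskianAt z hx (zDeriv θ (k + 1) z)]
            linear_combination (wronskianAt (θ z) (zDeriv θ (k + 1) z) x * φ z x) * e1 -
              (wronskianAt (φ z) (zDeriv θ (k + 1) z) x * θ z x) * e2
          · congr 1
            rw [cTheta_succ, ← hK]
            push_cast
            rw [show (2 * K - (2 * l + 1) : ℂ) = -(2 * l + 1 - 2 * K) by ring, mul_one, one_mul]
            exact coefficient_recursion hpC hsC' hKC (by ring)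
        · have h3 := (A2.mul
            ((h.regular.deriv_asymptotics (exponent_regular l) h.integrable).1 z)).sub
            (A1.mul ((h.singular.deriv_asymptotics (exponent_singular l) h.integrable).1 z))
          refine (h3.congr' ?_).trans_eq ?_
          · filter_upwards [self_mem_nhdsWithin] with x hx
            have e1 := ofReal_rpow_mul_rpow hx (-(2 * K - (2 * l + 1))) (1 - (l + 1))
            have e2 := ofReal_rpow_mul_rpow hx (-(2 * K)) (1 - -l)
            rw [show -(2 * K - (2 * l + 1)) + (1 - (l + 1)) = 1 - (-l + 2 * K) by ring] at e1
            rw [show -(2 * K) + (1 - -l) = 1 - (-l + 2 * K) by ring] at e2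
            rw [h.deriv_eq_wronskianAt z hx (zDeriv θ (k + 1) z)]
            linear_combination
              (wronskianAt (θ z) (zDeriv θ (k + 1) z) x * deriv (φ z) x) * e1 -
              (wronskianAt (φ z) (zDeriv θ (k + 1) z) x * deriv (θ z) x) * e2
          · congr 1
            rw [cTheta_succ, ← hK]
            push_cast
            rw [show (2 * K - (2 * l + 1) : ℂ) = -(2 * l + 1 - 2 * K) by ring, mul_one, one_mul]
            exact coefficient_recursion_deriv hpC hsC' hKC (by ring) rfl
      · refine (((h.singular.tendsto z).mul ih).const_mul (-K : ℂ)).congr' ?_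
        filter_upwards [self_mem_nhdsWithin] with x hx
        have e1 := ofReal_rpow_mul_rpow hx (- -l) (-(-l + 2 * k))
        rw [show - -l + -(-l + 2 * k) = 1 - (2 * K - (2 * l + 1)) by rw [hKk]; ring] at e1
        rw [← e1, hK]
        simp only [Nat.add_sub_cancel]
        push_cast
        ring
    · have h2 := ((h.regular.tendsto z).mul ih).const_mul (-K : ℂ)
      rw [Complex.ofReal_one] at h2
      refine h2.congr' ?_
      filter_upwards [self_mem_nhdsWithin] with x hx
      have e1 := ofReal_rpow_mul_rpow hx (-(l + 1)) (-(-l + 2 * k))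
      rw [show -(l + 1) + -(-l + 2 * k) = 1 - 2 * K by rw [hKk]; ring] at e1
      rw [← e1, hK]
      simp only [Nat.add_sub_cancel]
      push_cast
      ring

end IsBesselPair

/-! ### Entire primitives and the Frobenius part. -/

theorem iteratedDeriv_conj_conj (g : ℂ → ℂ) (k : ℕ) :
    iteratedDeriv k (starRingEnd ℂ ∘ g ∘ starRingEnd ℂ) =
      starRingEnd ℂ ∘ iteratedDeriv k g ∘ starRingEnd ℂ := by
  induction k with
  | zero => simp
  | succ k ih => rw [iteratedDeriv_succ, ih, deriv_conj_conj, iteratedDeriv_succ]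

theorem exists_entire_primitive {f : ℂ → ℂ} (hf : Differentiable ℂ f) :
    ∃ F : ℂ → ℂ, Differentiable ℂ F ∧ deriv F = f ∧
      ((∀ z, f (starRingEnd ℂ z) = starRingEnd ℂ (f z)) →
        ∀ z, F (starRingEnd ℂ z) = starRingEnd ℂ (F z)) := by
  obtain ⟨F, hF0, hF⟩ := hf.isExactOn_univ.with_val_at 0 0
  have hF' : ∀ z, HasDerivAt F (f z) z := fun z => hF z (mem_univ z)
  refine ⟨F, fun z => (hF' z).differentiableAt, funext fun z => (hF' z).deriv, fun hr z => ?_⟩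
  -- For real `f` the conjugate of `F` is another primitive, and both vanish at zero.
  have h1 : ∀ w, HasDerivAt (fun w => (starRingEnd ℂ ∘ F ∘ starRingEnd ℂ) w - F w) 0 w := by
    intro w
    have h2 := (hF' (starRingEnd ℂ w)).conj_conj
    rw [Complex.conj_conj, hr, Complex.conj_conj] at h2
    have h3 := h2.sub (hF' w)
    rw [sub_self] at h3
    exact h3
  have h3 := is_const_of_deriv_eq_zero (fun w => (h1 w).differentiableAt)
    (fun w => (h1 w).deriv) z 0
  simp only [Function.comp_apply, map_zero, hF0, sub_zero] at h3
  rw [← sub_eq_zero.1 h3, Complex.conj_conj]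

theorem exists_entire_iterated_primitive (m : ℕ) {f : ℂ → ℂ} (hf : Differentiable ℂ f) :
    ∃ F : ℂ → ℂ, Differentiable ℂ F ∧ iteratedDeriv m F = f ∧
      ((∀ z, f (starRingEnd ℂ z) = starRingEnd ℂ (f z)) →
        ∀ z, F (starRingEnd ℂ z) = starRingEnd ℂ (F z)) := by
  induction m generalizing f with
  | zero => exact ⟨f, hf, by simp, fun h => h⟩
  | succ m ih =>
    obtain ⟨G, hG, hGf, hGr⟩ := exists_entire_primitive hf
    obtain ⟨F, hF, hFG, hFr⟩ := ih hG
    exact ⟨F, hF, by rw [iteratedDeriv_succ, hFG, hGf], fun h => hFr (hGr h)⟩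

theorem iteratedDeriv_iteratedDeriv (F : ℂ → ℂ) (m k : ℕ) :
    iteratedDeriv k (iteratedDeriv m F) = iteratedDeriv (k + m) F := by
  rw [iteratedDeriv_eq_iterate, iteratedDeriv_eq_iterate, iteratedDeriv_eq_iterate,
    Function.iterate_add_apply]

theorem zDeriv_add (u : ℂ → ℝ → ℂ) (m k : ℕ) : zDeriv (zDeriv u m) k = zDeriv u (k + m) := by
  funext z x
  exact congrFun (iteratedDeriv_iteratedDeriv (fun w => u w x) m k) z

theorem differentiable_zDeriv {u : ℂ → ℝ → ℂ} {x : ℝ} (hu : Differentiable ℂ (fun z => u z x))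
    (k : ℕ) : Differentiable ℂ (fun z => zDeriv u k z x) :=
  hu.iteratedDeriv_entire k

theorem hasDerivAt_zDeriv_left {u : ℂ → ℝ → ℂ} {x : ℝ} (hu : Differentiable ℂ (fun z => u z x))
    (k : ℕ) (z : ℂ) : HasDerivAt (fun z => zDeriv u k z x) (zDeriv u (k + 1) z x) z := by
  have := (differentiable_zDeriv hu k z).hasDerivAt
  rwa [show deriv (fun z => zDeriv u k z x) z = zDeriv u (k + 1) z x by
    simp only [zDeriv, iteratedDeriv_succ]] at this

theorem tendsto_cobounded_of_rpow_mul {W : ℝ → ℂ} {e : ℝ} {C : ℂ} (he : 0 < e) (hC : C ≠ 0)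
    (h : Tendsto (fun x : ℝ => ((x ^ e : ℝ) : ℂ) * W x) (𝓝[>] 0) (𝓝 C)) :
    Tendsto W (𝓝[>] 0) (Bornology.cobounded ℂ) := by
  rw [← tendsto_norm_atTop_iff_cobounded]
  have h1 := (tendsto_rpow_atTop_of_neg (neg_neg_of_pos he)).atTop_mul_pos (norm_pos_iff.2 hC)
    h.norm
  refine h1.congr' ?_
  filter_upwards [self_mem_nhdsWithin] with x hx
  have hx : 0 < x := hx
  rw [norm_mul, Complex.norm_real, Real.norm_of_nonneg (by positivity), ← mul_assoc,
    ← Real.rpow_add hx]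
  simp

namespace IsBesselPair

variable {l : ℝ} {q : ℝ → ℝ} {φ θ : ℂ → ℝ → ℂ}

theorem differentiable_deriv_singular (h : IsBesselPair l q φ θ) {x : ℝ} (hx : 0 < x) :
    Differentiable ℂ (fun z => deriv (θ z) x) :=
  (h.singular.hasDerivAt_zDeriv (exponent_singular l) h.locallyIntegrable h.integrable hx).1

theorem deriv_singular_zDeriv (h : IsBesselPair l q φ θ) {x : ℝ} (hx : 0 < x) (k : ℕ) (z : ℂ) :
    deriv (zDeriv θ k z) x = zDeriv (fun z => deriv (θ z)) k z x :=
  h.singular.deriv_zDeriv (exponent_singular l) h.locallyIntegrable h.integrable hx k z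

/-- The limit `L` is entire, as a limit of a locally bounded family, and inherits the reality of
`θ`; its iterated primitive keeps both properties. -/
theorem exists_isFrobeniusPart (h : IsBesselPair l q φ θ) :
    ∃ F : ℂ → ℂ, IsFrobeniusPart l θ F ∧
      ((∀ (z : ℂ) (x : ℝ), 0 < x → θ (starRingEnd ℂ z) x = starRingEnd ℂ (θ z x)) →
        ∀ z : ℂ, F (starRingEnd ℂ z) = starRingEnd ℂ (F z)) := by
  choose L hL _ using h.exists_tendsto_singular_zDeriv
  have hLd : Differentiable ℂ L := h.powerBounded_singular_zDeriv_succ.1.differentiable_lim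
    (fun x hx => differentiable_zDeriv (h.singular.entire x hx) _) hL
  obtain ⟨F, hF, hFL, hFr⟩ := exists_entire_iterated_primitive (nBessel l + 1) hLd
  refine ⟨F, ⟨hF, fun z => by rw [hFL]; exact hL z⟩, fun hr => hFr fun z => ?_⟩
  have h1 := (Complex.continuous_conj.tendsto _).comp (hL z)
  refine tendsto_nhds_unique (hL (starRingEnd ℂ z)) (h1.congr' ?_)
  filter_upwards [self_mem_nhdsWithin] with x hx
  have e : (fun w => θ w x) = starRingEnd ℂ ∘ (fun w => θ w x) ∘ starRingEnd ℂ := by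
    funext w
    simp only [Function.comp_apply]
    rw [hr w x hx, Complex.conj_conj]
  have e2 : zDeriv θ (nBessel l + 1) (starRingEnd ℂ z) x =
      starRingEnd ℂ (zDeriv θ (nBessel l + 1) z x) := by
    have h2 := congrFun (iteratedDeriv_conj_conj (fun w => θ w x) (nBessel l + 1))
      (starRingEnd ℂ z)
    rw [← e, Function.comp_apply, Function.comp_apply, Complex.conj_conj] at h2
    exact h2
  rw [e2, Function.comp_apply, map_mul, Complex.conj_ofReal]

theorem tendsto_of_isFrobeniusPart (h : IsBesselPair l q φ θ) {F : ℂ → ℂ}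
    (hF : IsFrobeniusPart l θ F) {i : ℕ} (hi : nBessel l + 1 ≤ i) (z : ℂ) :
    Tendsto (fun x : ℝ => ((x ^ (-(l + 1)) : ℝ) : ℂ) * zDeriv θ i z x) (𝓝[>] 0)
      (𝓝 (iteratedDeriv i F z)) ∧
    Tendsto (fun x : ℝ => ((x ^ (1 - (l + 1)) : ℝ) : ℂ) * deriv (zDeriv θ i z) x) (𝓝[>] 0)
      (𝓝 ((l + 1) * iteratedDeriv i F z)) := by
  set n := nBessel l with hn
  obtain ⟨k, rfl⟩ : ∃ k, i = k + (n + 1) := ⟨i - (n + 1), by omega⟩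
  obtain ⟨hP, hP'⟩ := h.powerBounded_singular_zDeriv_succ
  have hl2 : ∀ z, Tendsto (fun x : ℝ => ((x ^ (-l) : ℝ) : ℂ) *
      zDeriv (fun z => deriv (θ z)) (n + 1) z x) (𝓝[>] 0)
      (𝓝 ((l + 1) * iteratedDeriv (n + 1) F z)) := by
    intro z
    obtain ⟨L, h1, h2⟩ := h.exists_tendsto_singular_zDeriv z
    rw [tendsto_nhds_unique h1 (hF.2 z)] at h2
    refine h2.congr' ?_
    filter_upwards [self_mem_nhdsWithin] with x hx
    rw [h.deriv_singular_zDeriv hx]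
  constructor
  · have h1 := hP.tendsto_zDeriv
      (fun x hx => differentiable_zDeriv (h.singular.entire x hx) _) hF.2 k z
    rwa [iteratedDeriv_iteratedDeriv, zDeriv_add] at h1
  · have hP2 : PowerBounded (zDeriv (fun z => deriv (θ z)) (n + 1)) l :=
      hP'.congr fun z x hx => (h.deriv_singular_zDeriv hx _ z).symm
    have h1 := hP2.tendsto_zDeriv
      (fun x hx => differentiable_zDeriv (h.differentiable_deriv_singular hx) _) hl2 k z
    rw [zDeriv_add, iteratedDeriv_const_mul_field, iteratedDeriv_iteratedDeriv] at h1
    refine h1.congr' ?_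
    filter_upwards [self_mem_nhdsWithin] with x hx
    rw [h.deriv_singular_zDeriv hx, show 1 - (l + 1) = -l by ring]

/-- The exponents `l + 1` and `-l` add up to one, so only leading coefficients matter: `(-l - (l +
1)) / (2 l + 1) = -1` for `j = 0`, while `θ^(j) = o(x ^ (-l))` otherwise. -/
theorem tendsto_wronskianAt_isFrobeniusPart (h : IsBesselPair l q φ θ) {F : ℂ → ℂ}
    (hF : IsFrobeniusPart l θ F) {i : ℕ} (hi : nBessel l + 1 ≤ i) (j : ℕ) (z ζ : ℂ) :
    Tendsto (wronskianAt (zDeriv θ i z) (zDeriv θ j ζ)) (𝓝[>] 0)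
      (𝓝 (if j = 0 then -iteratedDeriv i F z else 0)) := by
  obtain ⟨h1, h2⟩ := h.tendsto_of_isFrobeniusPart hF hi z
  have h3 := h.singular.tendsto_zDeriv j ζ
  have h4 := h.singular.tendsto_deriv_zDeriv (exponent_singular l) h.locallyIntegrable
    h.integrable j ζ
  have h5 := tendsto_rpow_mul_wronskianAt h1 h2 h3 h4
  have h6 := tendsto_wronskianAt_of_add_eq_one (by ring) h5
  convert h6 using 2
  have hc : (1 / (2 * l + 1) : ℂ) * (2 * l + 1) = 1 := one_div_mul_cancel h.ne_zero
  split_ifs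
  · push_cast
    linear_combination iteratedDeriv i F z * hc
  · simp

/-! ### Wronskians of two spectral derivatives of `θ`. -/

/-- Uniformity in `z` with `ζ` frozen is what the mean value argument in `z` requires. -/
theorem powerBounded_wronskianAt_zDeriv (h : IsBesselPair l q φ θ) {i j : ℕ} (hi : i ≤ nBessel l)
    (hj : j ≤ nBessel l) (ζ : ℂ) :
    PowerBounded (fun z => wronskianAt (zDeriv θ i z) (zDeriv θ j ζ))
      (2 * ((i + j : ℕ) : ℝ) - (2 * l + 1) - 2 * loss l) := by
  obtain ⟨h1, h2⟩ := h.powerBounded_singular_zDeriv hi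
  obtain ⟨h3, h4⟩ := h.powerBounded_singular_zDeriv hj
  have h5 := h1.mul (h4.const_left ζ)
  have h6 := h2.mul (h3.const_left ζ)
  have e1 : -l + 2 * (i : ℝ) - loss l + (-l + 2 * (j : ℝ) - loss l - 1) =
    2 * ((i + j : ℕ) : ℝ) - (2 * l + 1) - 2 * loss l := by push_cast; ring
  have e2 : -l + 2 * (i : ℝ) - loss l - 1 + (-l + 2 * (j : ℝ) - loss l) =
    2 * ((i + j : ℕ) : ℝ) - (2 * l + 1) - 2 * loss l := by push_cast; ring
  rw [e1] at h5
  rw [e2] at h6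
  exact h5.sub h6

theorem exponent_pos (l : ℝ) {m : ℕ} (hm : nBessel l + 1 ≤ m) :
    0 < 2 * (m : ℝ) - (2 * l + 1) - 2 * loss l := by
  have h1 : (nBessel l : ℝ) + 1 ≤ m := by exact_mod_cast hm
  have h2 := lt_nBessel l
  have h3 : loss l = (nBessel l + 1 - (l + 1 / 2)) / 2 := rfl
  linarith

theorem tendsto_wronskianAt_zero_of_le (h : IsBesselPair l q φ θ) {i j : ℕ} (hi : i ≤ nBessel l)
    (hj : j ≤ nBessel l) (hij : nBessel l + 1 ≤ i + j) (z ζ : ℂ) :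
    Tendsto (wronskianAt (zDeriv θ i z) (zDeriv θ j ζ)) (𝓝[>] 0) (𝓝 0) := by
  have h1 := (h.powerBounded_wronskianAt_zDeriv hi hj ζ).tendsto_zero (a := 0)
    (by rw [zero_add]; exact exponent_pos l hij) z
  simpa using h1

/-- The Wronskian of `∂_z^i θ(z)` and `∂_z^i θ(ζ)` is controlled by the mean value theorem
in `z`. -/
theorem tendsto_wronskianAt_zero_of_eq (h : IsBesselPair l q φ θ) {i : ℕ} (hi : i ≠ 0)
    (hin : i + i = nBessel l) (z ζ : ℂ) :
    Tendsto (wronskianAt (zDeriv θ i z) (zDeriv θ i ζ)) (𝓝[>] 0) (𝓝 0) := by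
  -- The Wronskian vanishes at `z = ζ` and its `z`-derivative has orders `i + 1` and `i`. Their sum
  -- is `n_l + 1`, which makes the exponent positive, and `i + 1 ≤ n_l` because `i ≥ 1`.
  obtain ⟨M, hM⟩ := h.powerBounded_wronskianAt_zDeriv (i := i + 1) (j := i) (by omega) (by omega) ζ
    (max ‖z‖ ‖ζ‖)
  have hpos := exponent_pos l (m := i + 1 + i) (by omega)
  set e : ℝ := 2 * ((i + 1 + i : ℕ) : ℝ) - (2 * l + 1) - 2 * loss l with he
  have hlim : Tendsto (fun x : ℝ => M * x ^ e * ‖z - ζ‖) (𝓝[>] 0) (𝓝 0) := by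
    simpa using ((tendsto_rpow_zero hpos).const_mul M).mul_const ‖z - ζ‖
  refine squeeze_zero_norm' ?_ hlim
  filter_upwards [Ioc_mem_nhdsGT (zero_lt_one (α := ℝ))] with x hx
  have hd : ∀ w, HasDerivAt (fun w => wronskianAt (zDeriv θ i w) (zDeriv θ i ζ) x)
      (wronskianAt (zDeriv θ (i + 1) w) (zDeriv θ i ζ) x) w := by
    intro w
    have h1 := hasDerivAt_zDeriv_left (h.singular.entire x hx.1) i w
    have h2 := hasDerivAt_zDeriv_left (h.differentiable_deriv_singular hx.1) i w
    simp only [wronskianAt, h.deriv_singular_zDeriv hx.1]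
    exact (h1.mul_const _).sub (h2.mul_const _)
  have h3 := (convex_closedBall (0 : ℂ) (max ‖z‖ ‖ζ‖)).norm_image_sub_le_of_norm_hasDerivWithin_le
    (C := M * x ^ e) (x := ζ) (y := z) (fun w _ => (hd w).hasDerivWithinAt)
    (fun w hw => hM w (by simpa using hw) x hx) (by simp) (by simp)
  have h4 : wronskianAt (zDeriv θ i ζ) (zDeriv θ i ζ) x = 0 := by
    simp only [wronskianAt]; ring
  rwa [h4, sub_zero] at h3

/-- The factor `2 (j - i)` is the difference of the exponents `2 j - l` and `2 i - l`. -/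
theorem tendsto_rpow_mul_wronskianAt_singular (h : IsBesselPair l q φ θ) {i j : ℕ}
    (hi : (2 * i : ℝ) < 2 * l + 1) (hj : (2 * j : ℝ) < 2 * l + 1) (z ζ : ℂ) :
    Tendsto (fun x : ℝ => ((x ^ (2 * l + 1 - 2 * ((i + j : ℕ) : ℝ)) : ℝ) : ℂ) *
      wronskianAt (zDeriv θ i z) (zDeriv θ j ζ) x) (𝓝[>] 0)
      (𝓝 ((2 * ((j : ℝ) - i) / (2 * l + 1) ^ 2 * cTheta l j * cTheta l i : ℝ) : ℂ)) := by
  obtain ⟨h1, h2⟩ := h.tendsto_singular_zDeriv hi z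
  obtain ⟨h3, h4⟩ := h.tendsto_singular_zDeriv hj ζ
  have h5 := tendsto_rpow_mul_wronskianAt h1 h2 h3 h4
  have e : 1 - (-l + 2 * (i : ℝ) + (-l + 2 * (j : ℝ))) = 2 * l + 1 - 2 * ((i + j : ℕ) : ℝ) := by
    push_cast; ring
  rw [e] at h5
  convert h5 using 2
  have := h.ne_zero
  push_cast
  field_simp
  ring

theorem tendsto_wronskianAt_cobounded (h : IsBesselPair l q φ θ) {i j : ℕ} (hij : i ≠ j)
    (hlt : ((i + j : ℕ) : ℝ) < l + 1 / 2) (z ζ : ℂ) :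
    Tendsto (wronskianAt (zDeriv θ i z) (zDeriv θ j ζ)) (𝓝[>] 0) (Bornology.cobounded ℂ) := by
  have hp := h.pos
  push_cast at hlt
  have hi0 : (0 : ℝ) ≤ i := Nat.cast_nonneg i
  have hj0 : (0 : ℝ) ≤ j := Nat.cast_nonneg j
  have hi : (2 * i : ℝ) < 2 * l + 1 := by linarith
  have hj : (2 * j : ℝ) < 2 * l + 1 := by linarith
  refine tendsto_cobounded_of_rpow_mul (by push_cast; linarith) ?_
    (h.tendsto_rpow_mul_wronskianAt_singular hi hj z ζ)
  have h1 : (j : ℝ) - i ≠ 0 := sub_ne_zero.2 (by exact_mod_cast hij.symm)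
  have h2 := cTheta_ne_zero hi
  have h3 := cTheta_ne_zero hj
  have h4 := hp.ne'
  exact_mod_cast (by positivity :
    2 * ((j : ℝ) - i) / (2 * l + 1) ^ 2 * cTheta l j * cTheta l i ≠ 0)

/-- The logarithmic case. -/
theorem tendsto_wronskianAt_cobounded_log (h : IsBesselPair l q φ θ) (hn0 : nBessel l ≠ 0)
    (hn : (nBessel l : ℝ) = l + 1 / 2) (z ζ : ℂ) :
    Tendsto (wronskianAt (θ z) (zDeriv θ (nBessel l) ζ)) (𝓝[>] 0) (Bornology.cobounded ℂ) := by
  have hp := h.pos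
  obtain ⟨k, hk⟩ := Nat.exists_eq_succ_of_ne_zero hn0
  have hPn := (h.powerBounded_singular_zDeriv le_rfl).1
  have hε := h.loss_le
  rw [hk] at hn hPn ⊢
  rw [Nat.succ_eq_add_one] at *
  push_cast at hn hPn
  have hk2 : (2 * k : ℝ) < 2 * l + 1 := by linarith
  obtain ⟨h1, -⟩ := h.tendsto_singular_zDeriv hk2 ζ
  have h0 := h.singular.tendsto z
  -- As `2 (k + 1) = 2 l + 1`, the product `θ θ^(k)` is of exact order `1 / x`, while the term with
  -- `z - ζ`, multiplied by `x`, tends to zero.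
  refine tendsto_cobounded_of_deriv
    (c := (z - ζ) * (((1 / (2 * l + 1) : ℝ) : ℂ) * 0) - ((k + 1 : ℕ) : ℂ) *
      (((1 / (2 * l + 1) : ℝ) : ℂ) * ((cTheta l k / (2 * l + 1) : ℝ) : ℂ))) ?_
    (fun x hx => h.hasDerivAt_wronskianAt_singular (k + 1) z ζ hx) ?_
  · rw [mul_zero, mul_zero, zero_sub]
    have h2 := cTheta_ne_zero hk2
    have h3 : ((k + 1 : ℕ) : ℝ) ≠ 0 := by positivity
    have h4 := hp.ne'
    have h5 : ((k + 1 : ℕ) : ℝ) * (1 / (2 * l + 1) * (cTheta l k / (2 * l + 1))) ≠ 0 := by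
      positivity
    exact neg_ne_zero.2 (by exact_mod_cast h5)
  · have h2 := hPn.tendsto_zero (a := 1 - l) (by linarith) ζ
    refine (((h0.mul h2).const_mul (z - ζ)).sub ((h0.mul h1).const_mul ((k + 1 : ℕ) : ℂ))).congr' ?_
    filter_upwards [self_mem_nhdsWithin] with x hx
    have e1 := ofReal_rpow_mul_rpow hx (- -l) (1 - l)
    have e2 := ofReal_rpow_mul_rpow hx (- -l) (-(-l + 2 * k))
    rw [show - -l + (1 - l) = 1 by ring, Real.rpow_one] at e1
    rw [show - -l + -(-l + 2 * (k : ℝ)) = 1 by linarith, Real.rpow_one] at e2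
    simp only [Nat.add_sub_cancel]
    linear_combination ((z - ζ) * θ z x * zDeriv θ (k + 1) ζ x) * e1 -
      (((k + 1 : ℕ) : ℂ) * θ z x * zDeriv θ k ζ x) * e2

end IsBesselPair

/-! ### Assembly of the statements. -/

theorem Filter.Tendsto.wronskianAt_antisymm {f g : ℝ → ℂ} {c : ℂ} {𝓕 : Filter ℝ}
    (h : Tendsto (wronskianAt f g) 𝓕 (𝓝 c)) : Tendsto (wronskianAt g f) 𝓕 (𝓝 (-c)) :=
  h.neg.congr fun x => (_root_.wronskianAt_antisymm g f x).symm

theorem corollary3p9 (l : ℝ) (hl : -1 / 2 < l) (q : ℝ → ℝ)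
    (hq : LocallyIntegrableOn q (Ioi 0)) (hxq : IntegrableOn (fun x => x * q x) (Ioo 0 1))
    (φ θ : ℂ → ℝ → ℂ)
    (hφ : IsNormalizedEntireSolution l q 1 (l + 1) φ)
    (hθ : IsNormalizedEntireSolution l q (1 / (2 * l + 1)) (-l) θ) :
    -- all the functions whose Wronskians occur are differentiable in `x`
    (∀ (k : ℕ) (z : ℂ) (x : ℝ), 0 < x →
      DifferentiableAt ℝ (zDeriv φ k z) x ∧ DifferentiableAt ℝ (zDeriv θ k z) x) ∧
    -- (i)
    (∀ (z : ℂ) (x : ℝ), 0 < x → wronskianAt (θ z) (φ z) x = 1) ∧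
    -- (ii)
    (∀ z ζ : ℂ, Tendsto (wronskianAt (θ z) (φ ζ)) (𝓝[>] 0) (𝓝 1)) ∧
    -- (iii)
    (∀ (z ζ : ℂ) (i j : ℕ),
      Tendsto (wronskianAt (zDeriv φ i z) (zDeriv φ j ζ)) (𝓝[>] 0) (𝓝 0)) ∧
    -- (iv)
    (∀ (z ζ : ℂ) (i j : ℕ), 1 ≤ i + j →
      Tendsto (wronskianAt (zDeriv θ i z) (zDeriv φ j ζ)) (𝓝[>] 0) (𝓝 0)) ∧
    -- (v)
    (∀ (z ζ : ℂ) (i j : ℕ),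
      (i ≠ j → i + j < nBessel l →
        Tendsto (wronskianAt (zDeriv θ i z) (zDeriv θ j ζ)) (𝓝[>] 0) (Bornology.cobounded ℂ)) ∧
      (i ≠ j → i + j = nBessel l → (i * j = 0 ∨ (nBessel l : ℝ) ≠ l + 1 / 2) →
        Tendsto (wronskianAt (zDeriv θ i z) (zDeriv θ j ζ)) (𝓝[>] 0) (Bornology.cobounded ℂ)) ∧
      (i + j = nBessel l → 0 < i * j → (i = j ∨ (nBessel l : ℝ) = l + 1 / 2) →
        Tendsto (wronskianAt (zDeriv θ i z) (zDeriv θ j ζ)) (𝓝[>] 0)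
          (𝓝 ((2 * ((j : ℝ) - i) / (2 * l + 1) ^ 2 * cTheta l j * cTheta l i : ℝ) : ℂ)))) ∧
    -- (vi)
    (∃ F : ℂ → ℂ, IsFrobeniusPart l θ F ∧
      ((∀ (z : ℂ) (x : ℝ), 0 < x → θ (starRingEnd ℂ z) x = starRingEnd ℂ (θ z x)) →
        ∀ z : ℂ, F (starRingEnd ℂ z) = starRingEnd ℂ (F z))) ∧
    (∀ F : ℂ → ℂ, IsFrobeniusPart l θ F → ∀ (z ζ : ℂ) (i j : ℕ), nBessel l + 1 ≤ i + j →
      (j = 0 → Tendsto (wronskianAt (zDeriv θ i z) (zDeriv θ j ζ)) (𝓝[>] 0)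
        (𝓝 (-iteratedDeriv i F z))) ∧
      (i = 0 → Tendsto (wronskianAt (zDeriv θ i z) (zDeriv θ j ζ)) (𝓝[>] 0)
        (𝓝 (iteratedDeriv j F ζ))) ∧
      (i * j ≠ 0 → Tendsto (wronskianAt (zDeriv θ i z) (zDeriv θ j ζ)) (𝓝[>] 0) (𝓝 0))) := by
  have h : IsBesselPair l q φ θ := ⟨hl, hq, hxq, hφ, hθ⟩
  refine ⟨fun k z x hx => ⟨?_, ?_⟩, fun z x hx => h.wronskianAt_eq_one z hx, fun z ζ => ?_,
    h.tendsto_wronskianAt_regular, fun z ζ i j hij => ?_, fun z ζ i j => ⟨fun hij hlt => ?_,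
    fun hij heq hcase => ?_, fun heq hpos hcase => ?_⟩, h.exists_isFrobeniusPart,
    fun F hF z ζ i j hij => ⟨fun hj => ?_, fun hi => ?_, fun hne => ?_⟩⟩
  · exact ((hφ.hasDerivAt_zDeriv (IsBesselPair.exponent_regular l) hq hxq hx).2 k z).differentiableAt
  · exact ((hθ.hasDerivAt_zDeriv (IsBesselPair.exponent_singular l) hq hxq hx).2 k z).differentiableAt
  · simpa [zDeriv_zero] using h.tendsto_wronskianAt_singular_regular z ζ 0 0
  · have := h.tendsto_wronskianAt_singular_regular z ζ i j
    rwa [if_neg (by omega)] at this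
  · refine h.tendsto_wronskianAt_cobounded hij (lt_of_lt_of_le ?_ h.nBessel_le) z ζ
    exact_mod_cast hlt
  · rcases eq_or_ne (nBessel l : ℝ) (l + 1 / 2) with hn | hn
    · have h0 : i * j = 0 := hcase.resolve_right fun hne => hne hn
      have hn0 : nBessel l ≠ 0 := by omega
      rcases Nat.mul_eq_zero.1 h0 with rfl | rfl
      · rw [zero_add] at heq
        rw [heq, zDeriv_zero]
        exact h.tendsto_wronskianAt_cobounded_log hn0 hn z ζ
      · rw [add_zero] at heq
        rw [heq, zDeriv_zero]
        have h1 := h.tendsto_wronskianAt_cobounded_log hn0 hn ζ z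
        rw [← tendsto_norm_atTop_iff_cobounded] at h1 ⊢
        refine h1.congr fun x => ?_
        rw [wronskianAt_antisymm, norm_neg]
    · refine h.tendsto_wronskianAt_cobounded hij ?_ z ζ
      rw [heq]
      exact lt_of_le_of_ne h.nBessel_le hn
  · have hi0 : 0 < i := Nat.pos_of_mul_pos_right hpos
    have hj0 : 0 < j := Nat.pos_of_mul_pos_left hpos
    rcases eq_or_ne i j with rfl | hne
    · simpa using h.tendsto_wronskianAt_zero_of_eq (by omega) heq z ζ
    · have hn := hcase.resolve_left hne
      -- Both indices are positive with sum `l + 1 / 2`, so each admits the leading asymptotics, and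
      -- the resulting exponent is zero: the limit is the coefficient itself.
      have e : ((i + j : ℕ) : ℝ) = l + 1 / 2 := by rw [heq, hn]
      have hi1 : (0 : ℝ) < i := by exact_mod_cast hi0
      have hj1 : (0 : ℝ) < j := by exact_mod_cast hj0
      push_cast at e
      have h1 := h.tendsto_rpow_mul_wronskianAt_singular (i := i) (j := j) (by linarith)
        (by linarith) z ζ
      rw [show 2 * l + 1 - 2 * ((i + j : ℕ) : ℝ) = 0 by push_cast; linarith] at h1
      simpa only [Real.rpow_zero, Complex.ofReal_one, one_mul] using h1
  · subst hj
    simpa using h.tendsto_wronskianAt_isFrobeniusPart hF (by omega) 0 z ζ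
  · subst hi
    simpa using (h.tendsto_wronskianAt_isFrobeniusPart hF (by omega : nBessel l + 1 ≤ j) 0 ζ
      z).wronskianAt_antisymm
  · obtain ⟨hi0, hj0⟩ := mul_ne_zero_iff.1 hne
    -- If one index exceeds `n_l`, its derivative is `O(x ^ (l + 1))` and the other is `o(x ^
    -- (-l))`; if neither does, the Wronskian is bounded by a positive power of `x`.
    rcases Nat.lt_or_ge (nBessel l) i with hi | hi
    · simpa [hj0] using h.tendsto_wronskianAt_isFrobeniusPart hF hi j z ζ
    · rcases Nat.lt_or_ge (nBessel l) j with hj | hj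
      · simpa [hi0] using (h.tendsto_wronskianAt_isFrobeniusPart hF hj i ζ z).wronskianAt_antisymm
      · exact h.tendsto_wronskianAt_zero_of_le hi hj hij z ζ
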